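/- Let $g\ge 1$. For a matrix $M=(m_{i,j})$ put $\|M\|_\infty=\max_{i,j}|m_{i,j}|$. Let $\mathbb H_g$ be the Siegel upper half space of symmetric $Z\in\mathrm{Mat}_g(\mathbb C)$ with $\operatorname{Im}Z>0$, on which $\mathrm{Sp}_{2g}(\mathbb Z)$ acts by $\begin{pmatrix}A&B\\C&D\end{pmatrix}\cdot Z=(AZ+B)(CZ+D)^{-1}$, and let $\mathfrak F_g\subset\mathbb H_g$ be the usual fundamental domain, i.e. the set of $Z=X+iY\in\mathbb H_g$ such that $\|X\|_\infty\le\frac12$, $Y$ is reduced in the sense of Minkowski, and $|\det(CZ+D)|\ge1$ for every $\begin{pmatrix}A&B\\C&D\end{pmatrix}\in\mathrm{Sp}_{2g}(\mathbb Z)$. For a finite index subgroup $\Gamma\le\mathrm{Sp}_{2g}(\mathbb Z)$ and a complete set $\sigma_1,\dots,\sigma_n$ of representatives of its right cosets $\Gamma s$, let $\mathfrak F_\Gamma=\bigcup_{i=1}^n\sigma_i\cdot\mathfrak F_g$. Let $A=V/\Lambda$ be a complex abelian variety of dimension $g$ with a polarization, given by a positive definite Hermitian form $H$ on $V$ (linear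 in the first variable) such that $E=\operatorname{Im}H$ is integral on $\Lambda$. Let $\lambda_1,\dots,\lambda_{2g}$ be a symplectic basis of $\Lambda$, i.e. $E$ is represented in it by $\begin{pmatrix}0&\mathbf D\\-\mathbf D&0\end{pmatrix}$, where $\mathbf D=\mathrm{diag}(d_1,\dots,d_g)$ with positive integers $d_1\mid d_2\mid\dots\mid d_g$, and put $d=d_1\cdots d_g$. Let $e_1,\dots,e_g$ be a basis of $V$ such that the period matrix (the coordinates of the $\lambda_j$ in the basis $e$, as columns) is $(\tau,\mathbf D)$. Let $\mathrm{End}^0(A)=\mathrm{End}(A)\otimes\mathbb Q$, let $\rho_r:\mathrm{End}^0(A)\to\mathrm{Mat}_{2g}(\mathbb Q)$ be the rational representation in the basis $\lambda_1,\dots,\lambda_{2g}$, and let $f^\dagger=\Phi^{-1}\circ\widehat f\circ\Phi$ be the Rosati involution on $\mathrm{End}^0(A)$, where $\Phi:A\to\widehat A$, $v\mapsto H(v,\cdot)$, is the isogeny to the dual abelian variety defined by the polarization. **Proposition.** Assume that $\tau\in\mathfrak F_\Gamma$, and let $Z_\tau\in\mathfrak F_g$ be in the same $\mathrm{Sp}_{2g}(\mathbb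 Z)$-orbit as $\tau$. Then, for every $f\in\mathrm{End}^0(A)$, $$c_1(A)\sqrt{\operatorname{tr}\rho_r(f^\dagger f)}\;\le\;\|\rho_r(f)\|_\infty\;\le\;c_2(A)\sqrt{\operatorname{tr}\rho_r(f^\dagger f)},$$ where $$c_1(A)=\frac1{2g}\sqrt{\frac{d_1}{d_g}},\qquad c_2(A)=\delta\cdot\frac{\|\mathbf D\|_\infty^{2g+2}}{d}\cdot\max\{1,\|\operatorname{Im}Z_\tau\|_\infty\}^{2g^3+3g^2+2g+1},$$ and $\delta$ is an effective positive constant depending only on $g$ and on the representatives $\sigma_1,\dots,\sigma_n$. More precisely, $\delta=\delta(g,N)$ for a computable function $\delta:\mathbb N\times\mathbb N\to\mathbb N_{>0}$, where $N$ is the largest absolute value of an entry of $\sigma_1,\dots,\sigma_n$. -/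

import Mathlib

open Matrix TensorProduct Topology Filter

noncomputable section

namespace ComplexTorus

/-! ### Complex tori `V / Λ` and their homomorphisms -/

section Hom

variable {V W U : Type*} [NormedAddCommGroup V] [NormedSpace ℂ V]
  [NormedAddCommGroup W] [NormedSpace ℂ W] [NormedAddCommGroup U] [NormedSpace ℂ U]

/-- A map `V / Λ → W / Λ'` of complex tori is holomorphic if near every point of `V` it is induced
by a holomorphic map with values in `W`. The complex structure of `V / Λ` is the one for which
`V → V / Λ` is a local biholomorphism, so this is holomorphy in charts. -/
def IsHolomorphic (Λ : Submodule ℤ V) (Λ' : Submodule ℤ W) (f : V ⧸ Λ → W ⧸ Λ') : Prop :=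
  ∀ v : V, ∃ F : V → W, ∀ᶠ z in 𝓝 v,
    DifferentiableAt ℂ F z ∧ (Submodule.Quotient.mk (F z) : W ⧸ Λ') = f (Submodule.Quotient.mk z)

/-- `Hom(V / Λ, W / Λ')`: the group of holomorphic group homomorphisms. -/
def Hom (Λ : Submodule ℤ V) (Λ' : Submodule ℤ W) : AddSubgroup (V ⧸ Λ →+ W ⧸ Λ') where
  carrier := {f | IsHolomorphic Λ Λ' f}
  zero_mem' := fun v => ⟨0, Eventually.of_forall fun z => ⟨differentiableAt_const 0, rfl⟩⟩
  add_mem' := by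
    intro f h hf hh v
    obtain ⟨F, hF⟩ := hf v
    obtain ⟨G, hG⟩ := hh v
    refine ⟨F + G, ?_⟩
    filter_upwards [hF, hG] with z h1 h2
    refine ⟨h1.1.add h2.1, ?_⟩
    rw [Pi.add_apply, Submodule.Quotient.mk_add, h1.2, h2.2]
    rfl
  neg_mem' := by
    intro f hf v
    obtain ⟨F, hF⟩ := hf v
    refine ⟨-F, ?_⟩
    filter_upwards [hF] with z h1
    refine ⟨h1.1.neg, ?_⟩
    rw [Pi.neg_apply, Submodule.Quotient.mk_neg, h1.2]
    rfl

/-- The homomorphism of tori induced by a `ℂ`-linear map which carries one lattice into the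
other. -/
def Hom.ofLinear (Λ : Submodule ℤ V) (Λ' : Submodule ℤ W) (F : V →L[ℂ] W)
    (hF : ∀ x ∈ Λ, F x ∈ Λ') : Hom Λ Λ' :=
  ⟨(Λ.mapQ Λ' (F.toLinearMap.restrictScalars ℤ) (fun x hx => hF x hx)).toAddMonoidHom,
    fun _ => ⟨F, Eventually.of_forall fun _ => ⟨F.differentiableAt, rfl⟩⟩⟩

/-- Composition of homomorphisms of tori. -/
def Hom.comp {Λ₁ : Submodule ℤ V} {Λ₂ : Submodule ℤ W} {Λ₃ : Submodule ℤ U}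
    (h : Hom Λ₂ Λ₃) (f : Hom Λ₁ Λ₂) : Hom Λ₁ Λ₃ :=
  ⟨h.1.comp f.1, by
    intro v
    obtain ⟨F, hF⟩ := f.2 v
    obtain ⟨G, hG⟩ := h.2 (F v)
    refine ⟨G ∘ F, ?_⟩
    have hc : Tendsto F (𝓝 v) (𝓝 (F v)) := hF.self_of_nhds.1.continuousAt
    filter_upwards [hF, hc.eventually hG] with z h1 h2
    refine ⟨h2.1.comp z h1.1, ?_⟩
    rw [Function.comp_apply, h2.2, h1.2]
    rfl⟩

theorem eventually_eq_zero {W : Type*} [NormedAddCommGroup W] (Λ' : Submodule ℤ W) [DiscreteTopology Λ'] :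
    ∀ᶠ x in 𝓝 (0 : W), x ∈ Λ' → x = 0 := by
  have hdis : DiscreteTopology (Λ' : Set W) := ‹_›
  have := (discreteTopology_subtype_iff.1 hdis) 0 Λ'.zero_mem
  have h2 : ∀ᶠ x in 𝓝[≠] (0 : W), x ∉ Λ' := by
    rw [Filter.inf_principal_eq_bot] at this
    exact this
  rw [eventually_nhdsWithin_iff] at h2
  filter_upwards [h2] with x hx hxΛ
  by_contra hne
  exact hx hne hxΛ

/-- Two continuous linear maps which agree modulo a discrete subgroup are equal. -/
theorem linear_lift_unique (Λ' : Submodule ℤ W) [DiscreteTopology Λ'] (F G : V →L[ℂ] W)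
    (h : ∀ v, (Submodule.Quotient.mk (F v) : W ⧸ Λ') = Submodule.Quotient.mk (G v)) : F = G := by
  have h0 := eventually_eq_zero Λ'
  ext v
  have ht : Tendsto (fun n : ℕ => ((2 : ℂ) ^ n)⁻¹ • (F v - G v)) atTop (𝓝 0) := by
    have : Tendsto (fun n : ℕ => ((2 : ℂ) ^ n)⁻¹) atTop (𝓝 0) := by
      have := tendsto_pow_atTop_nhds_zero_of_norm_lt_one (x := (2 : ℂ)⁻¹) (by norm_num)
      simpa using this
    simpa using this.smul_const (F v - G v)
  obtain ⟨n, hn⟩ := (ht.eventually h0).exists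
  have hm : ((2 : ℂ) ^ n)⁻¹ • (F v - G v) ∈ Λ' := by
    have := (Submodule.Quotient.eq Λ').1 (h (((2 : ℂ) ^ n)⁻¹ • v))
    simpa [smul_sub] using this
  have := hn hm
  rw [smul_eq_zero] at this
  rcases this with h1 | h1
  · exact absurd h1 (inv_ne_zero (pow_ne_zero _ two_ne_zero))
  · exact sub_eq_zero.1 h1

/-- Every homomorphism of complex tori is induced by a unique `ℂ`-linear map. -/
theorem Hom.exists_lift {Λ : Submodule ℤ V} {Λ' : Submodule ℤ W} [DiscreteTopology Λ']
    (f : Hom Λ Λ') : ∃ F : V →L[ℂ] W,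
      ∀ v, (Submodule.Quotient.mk (F v) : W ⧸ Λ') = f.1 (Submodule.Quotient.mk v) := by
  have h0 := eventually_eq_zero Λ'
  obtain ⟨F, hF⟩ := f.2 0
  have hF0 : F 0 ∈ Λ' := by
    have := hF.self_of_nhds.2
    rw [Submodule.Quotient.mk_zero, map_zero] at this
    exact (Submodule.Quotient.mk_eq_zero Λ').1 this
  have hd : HasFDerivAt F (fderiv ℂ F 0) 0 := hF.self_of_nhds.1.hasFDerivAt
  -- `2 (F (z / 2) - F 0) = F z - F 0` near the origin
  have hhalf : ∀ᶠ z in 𝓝 (0 : V), (2 : ℂ) • (F ((2 : ℂ)⁻¹ • z) - F 0) = F z - F 0 := by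
    have hs : Tendsto (fun z : V => (2 : ℂ)⁻¹ • z) (𝓝 0) (𝓝 0) := by
      have : Continuous fun z : V => (2 : ℂ)⁻¹ • z := by fun_prop
      simpa using this.tendsto 0
    have hc : Tendsto F (𝓝 0) (𝓝 (F 0)) := hd.continuousAt
    have ht : Tendsto (fun z => (2 : ℂ) • (F ((2 : ℂ)⁻¹ • z) - F 0) - (F z - F 0)) (𝓝 0) (𝓝 0) := by
      have := (((hc.comp hs).sub_const (F 0)).const_smul (2 : ℂ)).sub (hc.sub_const (F 0))
      simpa using this
    filter_upwards [ht.eventually h0, hF, hs.eventually hF] with z h1 h2 h3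
    refine sub_eq_zero.1 (h1 ?_)
    rw [← Submodule.Quotient.mk_eq_zero]
    have e0 : (Submodule.Quotient.mk (F 0) : W ⧸ Λ') = 0 :=
      (Submodule.Quotient.mk_eq_zero Λ').2 hF0
    have e1 : (z : V) = (2 : ℂ)⁻¹ • z + (2 : ℂ)⁻¹ • z := by
      rw [← add_smul]; norm_num
    have e2 : f.1 (Submodule.Quotient.mk z) = f.1 (Submodule.Quotient.mk ((2 : ℂ)⁻¹ • z)) +
        f.1 (Submodule.Quotient.mk ((2 : ℂ)⁻¹ • z)) := by
      rw [← map_add, ← Submodule.Quotient.mk_add, ← e1]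
    rw [two_smul, Submodule.Quotient.mk_sub, Submodule.Quotient.mk_add, Submodule.Quotient.mk_sub,
      Submodule.Quotient.mk_sub, h2.2, h3.2, e0, e2]
    abel
  obtain ⟨r, hr, hball⟩ := Metric.eventually_nhds_iff.1 (hhalf.and hF)
  have hpow : ∀ (n : ℕ) (z : V), ‖z‖ < r →
      ((2 : ℂ) ^ n) • (F (((2 : ℂ) ^ n)⁻¹ • z) - F 0) = F z - F 0 := by
    intro n
    induction n with
    | zero => intro z _; simp
    | succ k ih =>
      intro z hz
      have hz2 : ‖(2 : ℂ)⁻¹ • z‖ < r := by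
        rw [norm_smul]
        have : ‖(2 : ℂ)⁻¹‖ = 1 / 2 := by norm_num
        rw [this]
        have := norm_nonneg z
        linarith
      have h1 := ih _ hz2
      have h2 := (hball (y := z) (by simpa using hz)).1
      rw [← h2, ← h1, smul_smul, smul_smul]
      have e3 : ((2 : ℂ) ^ (k + 1))⁻¹ = ((2 : ℂ) ^ k)⁻¹ * (2 : ℂ)⁻¹ := by
        rw [pow_succ, mul_inv]
      have e4 : (2 : ℂ) ^ (k + 1) = 2 * 2 ^ k := by rw [pow_succ, mul_comm]
      rw [e3, e4]
  have htop : Tendsto (fun n : ℕ => ‖(2 : ℂ) ^ n‖) atTop atTop := by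
    simpa using tendsto_pow_atTop_atTop_of_one_lt (r := (2 : ℝ)) (by norm_num)
  have hlin : ∀ z : V, ‖z‖ < r → F z - F 0 = fderiv ℂ F 0 z := by
    intro z hz
    have hl := hd.lim z htop
    refine tendsto_nhds_unique (tendsto_const_nhds.congr fun n => ?_) hl
    rw [zero_add, hpow n z hz]
  refine ⟨fderiv ℂ F 0, fun v => ?_⟩
  have ht : Tendsto (fun n : ℕ => ((2 : ℂ) ^ n)⁻¹ • v) atTop (𝓝 0) := by
    have : Tendsto (fun n : ℕ => ((2 : ℂ) ^ n)⁻¹) atTop (𝓝 0) := by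
      have := tendsto_pow_atTop_nhds_zero_of_norm_lt_one (x := (2 : ℂ)⁻¹) (by norm_num)
      simpa using this
    simpa using this.smul_const v
  obtain ⟨n, hn⟩ := (ht.eventually (Metric.ball_mem_nhds 0 hr)).exists
  have hn' : ‖((2 : ℂ) ^ n)⁻¹ • v‖ < r := by simpa using hn
  set w := ((2 : ℂ) ^ n)⁻¹ • v with hw
  have hv : v = (2 ^ n : ℕ) • w := by
    rw [hw, ← Nat.cast_smul_eq_nsmul ℂ, smul_smul]
    simp
  have hwF : (Submodule.Quotient.mk (fderiv ℂ F 0 w) : W ⧸ Λ') = f.1 (Submodule.Quotient.mk w) := by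
    rw [← hlin w hn', Submodule.Quotient.mk_sub, (Submodule.Quotient.mk_eq_zero Λ').2 hF0, sub_zero]
    exact (hball (y := w) (by simpa using hn')).2.2
  have e5 : ∀ m : ℕ, (Submodule.Quotient.mk (m • w) : V ⧸ Λ) = m • Submodule.Quotient.mk w :=
    fun m => map_nsmul Λ.mkQ m w
  have e6 : ∀ (m : ℕ) (y : W), (Submodule.Quotient.mk (m • y) : W ⧸ Λ') =
    m • Submodule.Quotient.mk y := fun m y => map_nsmul Λ'.mkQ m y
  rw [hv, e5, map_nsmul, map_nsmul, e6, hwF]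

/-- The `ℂ`-linear map `V → W` inducing a homomorphism of tori (its analytic representation). -/
def Hom.lift {Λ : Submodule ℤ V} {Λ' : Submodule ℤ W} [DiscreteTopology Λ'] (f : Hom Λ Λ') :
    V →L[ℂ] W := (Hom.exists_lift f).choose

theorem Hom.mk_lift {Λ : Submodule ℤ V} {Λ' : Submodule ℤ W} [DiscreteTopology Λ'] (f : Hom Λ Λ')
    (v : V) : (Submodule.Quotient.mk (Hom.lift f v) : W ⧸ Λ') = f.1 (Submodule.Quotient.mk v) :=
  (Hom.exists_lift f).choose_spec v

theorem Hom.lift_mem {Λ : Submodule ℤ V} {Λ' : Submodule ℤ W} [DiscreteTopology Λ'] (f : Hom Λ Λ')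
    (x : V) (hx : x ∈ Λ) : Hom.lift f x ∈ Λ' := by
  rw [← Submodule.Quotient.mk_eq_zero, Hom.mk_lift f, (Submodule.Quotient.mk_eq_zero Λ).2 hx, map_zero]

theorem Hom.lift_add {Λ : Submodule ℤ V} {Λ' : Submodule ℤ W} [DiscreteTopology Λ']
    (f h : Hom Λ Λ') : Hom.lift (f + h) = Hom.lift f + Hom.lift h := by
  refine linear_lift_unique Λ' _ _ fun v => ?_
  rw [Hom.mk_lift, _root_.add_apply, Submodule.Quotient.mk_add, Hom.mk_lift,
    Hom.mk_lift]
  rfl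

/-- The homomorphism `Λ → Λ'` of lattices induced by a homomorphism of tori. -/
def Hom.latticeMap {Λ : Submodule ℤ V} {Λ' : Submodule ℤ W} [DiscreteTopology Λ'] (f : Hom Λ Λ') :
    Λ →ₗ[ℤ] Λ' :=
  ((Hom.lift f).toLinearMap.restrictScalars ℤ).restrict (Hom.lift_mem f)

/-- `Hom⁰(V / Λ, W / Λ') = Hom(V / Λ, W / Λ') ⊗ ℚ`. -/
abbrev Hom0 (Λ : Submodule ℤ V) (Λ' : Submodule ℤ W) : Type _ := ℚ ⊗[ℤ] Hom Λ Λ'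

/-- The image of a homomorphism in `Hom⁰`. -/
def Hom0.of {Λ : Submodule ℤ V} {Λ' : Submodule ℤ W} (f : Hom Λ Λ') : Hom0 Λ Λ' := 1 ⊗ₜ[ℤ] f

/-- The identity in `End⁰(V / Λ)`. -/
def Hom0.id (Λ : Submodule ℤ V) : Hom0 Λ Λ :=
  Hom0.of (Hom.ofLinear Λ Λ (ContinuousLinearMap.id ℂ V) fun _ hx => hx)

/-- Composition of homomorphisms as a `ℤ`-bilinear map. -/
def Hom.compBilin (Λ₁ : Submodule ℤ V) (Λ₂ : Submodule ℤ W) (Λ₃ : Submodule ℤ U) :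
    Hom Λ₂ Λ₃ →ₗ[ℤ] Hom Λ₁ Λ₂ →ₗ[ℤ] Hom Λ₁ Λ₃ :=
  LinearMap.mk₂ ℤ Hom.comp
    (fun _ _ _ => rfl)
    (fun _ _ _ => rfl)
    (fun h f f' => Subtype.ext (AddMonoidHom.ext fun x => map_add h.1 (f.1 x) (f'.1 x)))
    (fun c h f => Subtype.ext (AddMonoidHom.ext fun x => map_zsmul h.1 c (f.1 x)))

/-- Composition in `Hom⁰`, the `ℚ`-bilinear extension of the composition of homomorphisms:
`(p ⊗ h) ∘ (q ⊗ f) = p q ⊗ (h ∘ f)`. -/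
def Hom0.comp {Λ₁ : Submodule ℤ V} {Λ₂ : Submodule ℤ W} {Λ₃ : Submodule ℤ U}
    (h : Hom0 Λ₂ Λ₃) (f : Hom0 Λ₁ Λ₂) : Hom0 Λ₁ Λ₃ :=
  TensorProduct.map₂ (LinearMap.mul ℤ ℚ) (Hom.compBilin Λ₁ Λ₂ Λ₃) h f

theorem Hom0.comp_tmul {Λ₁ : Submodule ℤ V} {Λ₂ : Submodule ℤ W} {Λ₃ : Submodule ℤ U}
    (p q : ℚ) (h : Hom Λ₂ Λ₃) (f : Hom Λ₁ Λ₂) :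
    Hom0.comp (p ⊗ₜ[ℤ] h) (q ⊗ₜ[ℤ] f) = (p * q) ⊗ₜ[ℤ] Hom.comp h f := rfl

end Hom

/-! ### The rational representation -/

section RationalRepresentation

variable {V : Type*} [NormedAddCommGroup V] [NormedSpace ℂ V] {ι : Type*} [Fintype ι]
  [DecidableEq ι]

/-- The matrix, in a basis `b` of `Λ`, of the endomorphism of `Λ` induced by `f ∈ End(V / Λ)`. -/
def Hom.latticeMatrix {Λ : Submodule ℤ V} [DiscreteTopology Λ] (b : Module.Basis ι ℤ Λ) :
    Hom Λ Λ →+ Matrix ι ι ℤ :=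
  AddMonoidHom.mk' (fun f => LinearMap.toMatrix b b (Hom.latticeMap f)) fun f h => by
    rw [← map_add]
    congr 1
    refine LinearMap.ext fun x => Subtype.ext ?_
    change Hom.lift (f + h) (x : V) = Hom.lift f (x : V) + Hom.lift h (x : V)
    rw [Hom.lift_add]
    rfl

/-- The rational representation `ρ_r : End⁰(V / Λ) → Mat(ℚ)` in a basis `b` of `Λ`: it sends
`q ⊗ f` to `q` times the matrix of the endomorphism of `Λ` induced by `f`. -/
def ratRep {Λ : Submodule ℤ V} [DiscreteTopology Λ] (b : Module.Basis ι ℤ Λ) :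
    Hom0 Λ Λ →ₗ[ℤ] Matrix ι ι ℚ :=
  TensorProduct.lift (LinearMap.mk₂ ℤ
    (fun (q : ℚ) (f : Hom Λ Λ) => q • (Hom.latticeMatrix b f).map (Int.cast : ℤ → ℚ))
    (fun p q _ => add_smul p q _)
    (fun c q _ => smul_assoc c q _)
    (fun q f h => by rw [map_add, Matrix.map_add _ (fun a b => Int.cast_add a b), smul_add])
    (fun c q f => by
      have h : (c • Hom.latticeMatrix b f).map (Int.cast : ℤ → ℚ) =
          c • (Hom.latticeMatrix b f).map (Int.cast : ℤ → ℚ) := by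
        ext i j
        change ((c • Hom.latticeMatrix b f i j : ℤ) : ℚ) = c • ((Hom.latticeMatrix b f i j : ℤ) : ℚ)
        simp
      rw [map_zsmul, h, smul_comm]))

theorem ratRep_tmul {Λ : Submodule ℤ V} [DiscreteTopology Λ] (b : Module.Basis ι ℤ Λ) (q : ℚ)
    (f : Hom Λ Λ) :
    ratRep b (q ⊗ₜ[ℤ] f) = q • (Hom.latticeMatrix b f).map (Int.cast : ℤ → ℚ) := rfl

end RationalRepresentation

/-! ### The dual torus, polarizations and the Rosati involution -/

section Polarization

variable {V W : Type*} [NormedAddCommGroup V] [NormedSpace ℂ V] [NormedAddCommGroup W]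
  [NormedSpace ℂ W]

/-- The dual lattice `{l | Im l(Λ) ⊆ ℤ}` in the space of `ℂ`-antilinear functionals. The dual torus
of `V / Λ` is the quotient of this space by the dual lattice. -/
def dualLattice (Λ : Submodule ℤ V) : Submodule ℤ (V →L⋆[ℂ] ℂ) where
  carrier := {l | ∀ x ∈ Λ, ∃ n : ℤ, (l x).im = n}
  zero_mem' := fun _ _ => ⟨0, by simp⟩
  add_mem' := by
    intro l m hl hm x hx
    obtain ⟨a, ha⟩ := hl x hx
    obtain ⟨b, hb⟩ := hm x hx
    exact ⟨a + b, by simp [ha, hb]⟩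
  smul_mem' := by
    intro c _ hl x hx
    obtain ⟨a, ha⟩ := hl x hx
    exact ⟨c * a, by simp [ha]⟩

/-- The dual `f̂ : l ↦ l ∘ f` of a homomorphism of tori. -/
def Hom.dual {Λ : Submodule ℤ V} {Λ' : Submodule ℤ W} [DiscreteTopology Λ'] (f : Hom Λ Λ') :
    Hom (dualLattice Λ') (dualLattice Λ) :=
  Hom.ofLinear _ _
    ((ContinuousLinearMap.compSL V W ℂ (RingHom.id ℂ) (starRingEnd ℂ)).flip (Hom.lift f))
    (fun _ hl x hx => hl (Hom.lift f x) (Hom.lift_mem f x hx))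

theorem Hom.dual_add {Λ : Submodule ℤ V} {Λ' : Submodule ℤ W} [DiscreteTopology Λ']
    (f h : Hom Λ Λ') : Hom.dual (f + h) = Hom.dual f + Hom.dual h := by
  refine Subtype.ext (AddMonoidHom.ext fun x => ?_)
  obtain ⟨l, rfl⟩ := Submodule.Quotient.mk_surjective _ x
  have key : l.comp (Hom.lift (f + h)) = l.comp (Hom.lift f) + l.comp (Hom.lift h) := by
    rw [Hom.lift_add, ContinuousLinearMap.comp_add]
  exact congrArg (Submodule.Quotient.mk (p := dualLattice Λ)) key

/-- The map `f ↦ f̂` as a group homomorphism. -/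
def Hom.dualHom (Λ : Submodule ℤ V) (Λ' : Submodule ℤ W) [DiscreteTopology Λ'] :
    Hom Λ Λ' →+ Hom (dualLattice Λ') (dualLattice Λ) where
  toFun := Hom.dual
  map_zero' := by
    have h := Hom.dual_add (0 : Hom Λ Λ') 0
    rw [add_zero] at h
    exact left_eq_add.1 h
  map_add' := Hom.dual_add

/-- The dual of an element of `Hom⁰`, the `ℚ`-linear extension of `f ↦ f̂`. -/
def Hom0.dual {Λ : Submodule ℤ V} {Λ' : Submodule ℤ W} [DiscreteTopology Λ'] :
    Hom0 Λ Λ' →ₗ[ℤ] Hom0 (dualLattice Λ') (dualLattice Λ) :=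
  LinearMap.lTensor ℚ (Hom.dualHom Λ Λ').toIntLinearMap

/-- A polarization of the torus `V / Λ`: a positive definite Hermitian form on `V`, linear in the
first and antilinear in the second variable, whose imaginary part is integral on `Λ`. -/
structure Polarization (Λ : Submodule ℤ V) where
  form : V →L[ℂ] V →L⋆[ℂ] ℂ
  conj_symm : ∀ u v, form v u = starRingEnd ℂ (form u v)
  pos : ∀ v, v ≠ 0 → 0 < (form v v).re
  integral : ∀ x ∈ Λ, ∀ y ∈ Λ, ∃ n : ℤ, (form x y).im = n

namespace Polarization

variable {Λ : Submodule ℤ V} (L : Polarization Λ)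

/-- The alternating Riemann form `E = Im H`. -/
def E (u v : V) : ℝ := (L.form u v).im

/-- The isogeny `Φ` from the torus to its dual, given by `v ↦ H(v, ·)`. -/
def isogeny : Hom Λ (dualLattice Λ) := Hom.ofLinear _ _ L.form L.integral

open Classical in
/-- The inverse of the isogeny `Φ` in `Hom⁰`. If `Λ` is a lattice then `Φ` is an isogeny, so that the
two-sided inverse exists, and it is unique because composition is associative. -/
def isogenyInv : Hom0 (dualLattice Λ) Λ :=
  if h : ∃ Ψ : Hom0 (dualLattice Λ) Λ, Hom0.comp Ψ (Hom0.of L.isogeny) = Hom0.id Λ ∧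
    Hom0.comp (Hom0.of L.isogeny) Ψ = Hom0.id (dualLattice Λ) then h.choose else 0

/-- The Rosati involution `f† = Φ⁻¹ ∘ f̂ ∘ Φ` on `End⁰`. -/
def rosati [DiscreteTopology Λ] (f : Hom0 Λ Λ) : Hom0 Λ Λ :=
  Hom0.comp L.isogenyInv (Hom0.comp (Hom0.dual f) (Hom0.of L.isogeny))

/-- The basis `b` of `Λ` is symplectic for the polarization, of type `diag(d₁, …, d_g)`. -/
structure IsSymplecticBasis {g : ℕ} (d : Fin g → ℕ) (b : Module.Basis (Fin g ⊕ Fin g) ℤ Λ) :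
    Prop where
  pos : ∀ i, 0 < d i
  dvd : ∀ i j, i ≤ j → d i ∣ d j
  gram : Matrix.of (fun i j => L.E (b i) (b j)) =
    Matrix.fromBlocks 0 (Matrix.diagonal fun i => (d i : ℝ))
      (-Matrix.diagonal fun i => (d i : ℝ)) 0

end Polarization

/-- The period matrix: the columns are the coordinates of the lattice basis `b` in the basis `e`. -/
def periodMatrix {ι κ : Type*} {Λ : Submodule ℤ V} (e : Module.Basis κ ℂ V)
    (b : Module.Basis ι ℤ Λ) : Matrix κ ι ℂ := Matrix.of fun k i => e.repr (b i : V) k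

end Polarization

end ComplexTorus

/-! ### The Siegel upper half space and Siegel fundamental domains -/

namespace Siegel

/-- The Siegel upper half space of complex symmetric matrices with positive definite imaginary
part. -/
def upperHalfSpace (g : ℕ) : Set (Matrix (Fin g) (Fin g) ℂ) :=
  {Z | Zᵀ = Z ∧ (Z.map Complex.im).PosDef}

/-- `Sp_{2g}(ℤ)`, the group of integral matrices `M` with `M J ᵗM = J` (equivalently, `ᵗM J M = J`). -/
abbrev Sp (g : ℕ) : Type := Matrix.symplecticGroup (Fin g) ℤ

/-- The lower left block `C`, with complex entries. -/
def blockC {g : ℕ} (s : Sp g) : Matrix (Fin g) (Fin g) ℂ :=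
  (s : Matrix (Fin g ⊕ Fin g) (Fin g ⊕ Fin g) ℤ).toBlocks₂₁.map (Int.cast)

/-- The lower right block `D`, with complex entries. -/
def blockD {g : ℕ} (s : Sp g) : Matrix (Fin g) (Fin g) ℂ :=
  (s : Matrix (Fin g ⊕ Fin g) (Fin g ⊕ Fin g) ℤ).toBlocks₂₂.map (Int.cast)

/-- The upper left block `A`, with complex entries. -/
def blockA {g : ℕ} (s : Sp g) : Matrix (Fin g) (Fin g) ℂ :=
  (s : Matrix (Fin g ⊕ Fin g) (Fin g ⊕ Fin g) ℤ).toBlocks₁₁.map (Int.cast)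

/-- The upper right block `B`, with complex entries. -/
def blockB {g : ℕ} (s : Sp g) : Matrix (Fin g) (Fin g) ℂ :=
  (s : Matrix (Fin g ⊕ Fin g) (Fin g ⊕ Fin g) ℤ).toBlocks₁₂.map (Int.cast)

/-- The action `Z ↦ (A Z + B) (C Z + D)⁻¹`. -/
def act {g : ℕ} (s : Sp g) (Z : Matrix (Fin g) (Fin g) ℂ) : Matrix (Fin g) (Fin g) ℂ :=
  (blockA s * Z + blockB s) * (blockC s * Z + blockD s)⁻¹

/-- A real symmetric matrix `Y` is reduced in the sense of Minkowski if `ᵗa Y a ≥ y_{kk}` for every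
integral vector `a` with `gcd(a_k, …, a_g) = 1`, and `y_{k,k+1} ≥ 0`. -/
def IsMinkowskiReduced {g : ℕ} (Y : Matrix (Fin g) (Fin g) ℝ) : Prop :=
  (∀ (k : Fin g) (a : Fin g → ℤ), (Finset.univ.filter (k ≤ ·)).gcd a = 1 →
    Y k k ≤ (fun i => (a i : ℝ)) ⬝ᵥ (Y *ᵥ fun i => (a i : ℝ))) ∧
  ∀ i j : Fin g, (i : ℕ) + 1 = j → 0 ≤ Y i j

/-- The fundamental domain for the action of `Sp_{2g}(ℤ)` on the Siegel upper half space. -/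
def fundamentalDomain (g : ℕ) : Set (Matrix (Fin g) (Fin g) ℂ) :=
  {Z | Z ∈ upperHalfSpace g ∧ (∀ i j, |(Z i j).re| ≤ 1 / 2) ∧
    IsMinkowskiReduced (Z.map Complex.im) ∧ ∀ s : Sp g, 1 ≤ ‖(blockC s * Z + blockD s).det‖}

/-- `σ` is a complete set of representatives of the right cosets `Γ s` of `Γ`. -/
def IsRightCosetReps {g n : ℕ} (Γ : Subgroup (Sp g)) (σ : Fin n → Sp g) : Prop :=
  ∀ s : Sp g, ∃! i, s * (σ i)⁻¹ ∈ Γ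

/-- The Siegel fundamental domain `⋃ σ_i · F_g`. -/
def siegelDomain {g n : ℕ} (σ : Fin n → Sp g) : Set (Matrix (Fin g) (Fin g) ℂ) :=
  ⋃ i, act (σ i) '' fundamentalDomain g

/-- The largest absolute value of an entry of one of the matrices `σ_i`. -/
def maxEntry {g n : ℕ} (σ : Fin n → Sp g) : ℕ :=
  Finset.univ.sup fun p : Fin n × (Fin g ⊕ Fin g) × (Fin g ⊕ Fin g) =>
    ((σ p.1 : Matrix (Fin g ⊕ Fin g) (Fin g ⊕ Fin g) ℤ) p.2.1 p.2.2).natAbs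

end Siegel

/-- The norm `max |m_{ij}|` of a real matrix. -/
def supNorm {m n : Type*} [Fintype m] [Fintype n] (M : Matrix m n ℝ) : ℝ :=
  ‖fun p : m × n => M p.1 p.2‖

end

open ComplexTorus Siegel

/-! Both inequalities rest on one identity: `f†` is the adjoint of `f` for `H` (`form_lift_rosati`),
hence for `E = Im H` and for the real inner product `Re H`.

Lower bound. Adjointness for `E` on a symplectic basis matches every entry of `f†` with one entry of
`f`, up to sign and a ratio `d_i / d_j ≤ d_g / d_1`. So `tr(f† f)` is a sum of `(2g)²` products,
each at most `(d_g / d_1) ‖f‖²` (`trace_rosati_le`).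

Upper bound. Adjointness for `Re H` makes `tr(f† f)` the squared Hilbert-Schmidt norm of `f`, which
dominates the squared operator norm: `Re H(fλ, fλ) ≤ tr(f† f) Re H(λ, λ)`. An entry of `f`, times
some `±d_k`, is a value `E(λ_i, f λ_j)`, and Cauchy-Schwarz bounds it by `c √tr(f† f)`, where `c`
bounds all `H(λ_j, λ_j)` (`supNorm_realRep_le`).

It remains to bound `H(λ_j, λ_j)`. Up to factors `d_k`, the `λ_j` are the columns of `(τ, 1)`. If `τ
= σ_k Z'` with `Z'` in the fundamental domain, they are integral combinations, with coefficients the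
entries of `σ_k`, of the columns of `(Z', 1)` in another basis of `V`. In that basis the Gram matrix
of `H` is `(Im Z')⁻¹`, so a lower bound for the form `Im Z'` is needed. On nonzero integral vectors
it is at least `3/4`, by Minkowski reduction and the determinant condition, and Dirichlet
approximation transfers this to real vectors (`PosSemidef.sq_le_form`).

The resulting bound involves `Im Z'`, whereas the claim is about `Z_τ`, and the two points may
differ. Both describe the same lattice with the same `H`. The columns of `(Z_τ, 1)` are short, and
expanding them over `(Z', 1)` gives integral vectors on which `Im Z'` is small; Minkowski reduction
then bounds the diagonal of `Im Z'` (`IsFrame.abs_im_le`). This proves the bound with `D² · ‖Im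
Z_τ‖^(4g²)`, which is at most the stated one. -/

namespace ComplexTorus

/-! ### Real and imaginary parts of the Hermitian form. -/

section Forms

variable {V : Type*} [NormedAddCommGroup V] [NormedSpace ℂ V] {Λ : Submodule ℤ V}

namespace Polarization

variable (L : Polarization Λ)

/-- The real part of the Hermitian form, as a real bilinear form. -/
noncomputable def reForm : LinearMap.BilinForm ℝ V :=
  LinearMap.mk₂ ℝ (fun u v => (L.form u v).re)
    (fun u v w => by simp) (fun c u v => by
      rw [← Complex.coe_smul c u, map_smul]; simp)
    (fun u v w => by simp) (fun c u v => by
      rw [← Complex.coe_smul c v, ContinuousLinearMap.map_smulₛₗ]; simp)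

/-- The imaginary part of the Hermitian form, as a real bilinear form. -/
noncomputable def imForm : LinearMap.BilinForm ℝ V :=
  LinearMap.mk₂ ℝ (fun u v => (L.form u v).im)
    (fun u v w => by simp) (fun c u v => by
      rw [← Complex.coe_smul c u, map_smul]; simp)
    (fun u v w => by simp) (fun c u v => by
      rw [← Complex.coe_smul c v, ContinuousLinearMap.map_smulₛₗ]; simp)

theorem reForm_apply (u v : V) : L.reForm u v = (L.form u v).re := rfl

theorem imForm_apply (u v : V) : L.imForm u v = (L.form u v).im := rfl

theorem reForm_comm (u v : V) : L.reForm u v = L.reForm v u := by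
  rw [reForm_apply, reForm_apply, L.conj_symm v u, Complex.conj_re]

theorem imForm_swap (u v : V) : L.imForm u v = -L.imForm v u := by
  rw [imForm_apply, imForm_apply, L.conj_symm v u, Complex.conj_im]

theorem reForm_self_nonneg (v : V) : 0 ≤ L.reForm v v := by
  by_cases h : v = 0
  · simp [h]
  · exact (L.pos v h).le

theorem reForm_I_smul_I_smul (v : V) :
    L.reForm (Complex.I • v) (Complex.I • v) = L.reForm v v := by
  simp only [reForm_apply, map_smul, ContinuousLinearMap.map_smulₛₗ]
  simp

theorem imForm_eq_reForm_I_smul (u v : V) : L.imForm u v = L.reForm u (Complex.I • v) := by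
  simp only [reForm_apply, imForm_apply, ContinuousLinearMap.map_smulₛₗ]
  simp

/-- Multiplication by `i` is an isometry for `Re H` and `E(u, v) = Re H(u, iv)`, so this is
Cauchy-Schwarz for `Re H`. -/
theorem imForm_sq_le (u v : V) : L.imForm u v ^ 2 ≤ L.reForm u u * L.reForm v v := by
  rw [imForm_eq_reForm_I_smul, ← L.reForm_I_smul_I_smul v]
  exact LinearMap.BilinForm.apply_sq_le_of_symm L.reForm L.reForm_self_nonneg
    ⟨fun u v => L.reForm_comm u v⟩ u _

/-- The quadratic form of a sum is at most the number of terms times the sum of the values. -/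
theorem reForm_sum_self_le {ι : Type*} (s : Finset ι) (w : ι → V) :
    L.reForm (∑ i ∈ s, w i) (∑ i ∈ s, w i) ≤ s.card * ∑ i ∈ s, L.reForm (w i) (w i) := by
  have key : ∀ i j, 2 * L.reForm (w i) (w j) ≤ L.reForm (w i) (w i) + L.reForm (w j) (w j) := by
    intro i j
    have h := L.reForm_self_nonneg (w i - w j)
    have h2 := L.reForm_comm (w i) (w j)
    simp only [map_sub, LinearMap.sub_apply] at h
    linarith
  have h1 : 2 * L.reForm (∑ i ∈ s, w i) (∑ i ∈ s, w i) ≤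
      ∑ i ∈ s, ∑ j ∈ s, (L.reForm (w i) (w i) + L.reForm (w j) (w j)) := by
    simp only [map_sum, LinearMap.sum_apply, Finset.mul_sum]
    rw [Finset.sum_comm]
    exact Finset.sum_le_sum fun i _ => Finset.sum_le_sum fun j _ => key i j
  simp only [Finset.sum_add_distrib, Finset.sum_const, nsmul_eq_mul, ← Finset.mul_sum] at h1
  linarith

end Polarization

end Forms

/-! ### The analytic representation of `Hom⁰` and its link with the rational one. -/

section AnalyticRepresentation

variable {V W U : Type*} [NormedAddCommGroup V] [NormedSpace ℂ V]
  [NormedAddCommGroup W] [NormedSpace ℂ W] [NormedAddCommGroup U] [NormedSpace ℂ U]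

theorem Hom.lift_eq {Λ : Submodule ℤ V} {Λ' : Submodule ℤ W} [DiscreteTopology Λ'] (f : Hom Λ Λ')
    (F : V →L[ℂ] W)
    (h : ∀ v, f.1 (Submodule.Quotient.mk v) = (Submodule.Quotient.mk (F v) : W ⧸ Λ')) :
    Hom.lift f = F :=
  linear_lift_unique Λ' _ _ fun v => (Hom.mk_lift f v).trans (h v)

theorem Hom.lift_ofLinear {Λ : Submodule ℤ V} {Λ' : Submodule ℤ W} [DiscreteTopology Λ']
    (F : V →L[ℂ] W) (hF : ∀ x ∈ Λ, F x ∈ Λ') : Hom.lift (Hom.ofLinear Λ Λ' F hF) = F :=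
  Hom.lift_eq _ _ fun _ => rfl

theorem Hom.lift_comp {Λ₁ : Submodule ℤ V} {Λ₂ : Submodule ℤ W} {Λ₃ : Submodule ℤ U}
    [DiscreteTopology Λ₂] [DiscreteTopology Λ₃] (h : Hom Λ₂ Λ₃) (f : Hom Λ₁ Λ₂) :
    Hom.lift (Hom.comp h f) = (Hom.lift h).comp (Hom.lift f) :=
  Hom.lift_eq _ _ fun v => by
    change h.1 (f.1 _) = Submodule.Quotient.mk (Hom.lift h (Hom.lift f v))
    rw [Hom.mk_lift, Hom.mk_lift]

/-- The analytic representation as an additive map. -/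
noncomputable def Hom.liftHom (Λ : Submodule ℤ V) (Λ' : Submodule ℤ W) [DiscreteTopology Λ'] :
    Hom Λ Λ' →+ (V →L[ℂ] W) := AddMonoidHom.mk' Hom.lift Hom.lift_add

/-- The analytic representation of `Hom⁰`. -/
noncomputable def Hom0.lift {Λ : Submodule ℤ V} {Λ' : Submodule ℤ W} [DiscreteTopology Λ'] :
    Hom0 Λ Λ' →ₗ[ℤ] (V →L[ℂ] W) :=
  TensorProduct.lift (LinearMap.mk₂ ℤ (fun (q : ℚ) (f : Hom Λ Λ') => (q : ℂ) • Hom.liftHom Λ Λ' f)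
    (fun p q f => by push_cast; exact add_smul _ _ _)
    (fun c q f => by
      rw [zsmul_eq_mul, Rat.cast_mul, Rat.cast_intCast, mul_smul, Int.cast_smul_eq_zsmul])
    (fun q f h => by rw [map_add, smul_add])
    (fun c q f => by rw [map_zsmul, smul_comm]))

theorem Hom0.lift_tmul {Λ : Submodule ℤ V} {Λ' : Submodule ℤ W} [DiscreteTopology Λ'] (q : ℚ)
    (f : Hom Λ Λ') : Hom0.lift (q ⊗ₜ[ℤ] f) = (q : ℂ) • Hom.lift f := rfl

theorem Hom0.lift_of {Λ : Submodule ℤ V} {Λ' : Submodule ℤ W} [DiscreteTopology Λ']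
    (f : Hom Λ Λ') : Hom0.lift (Hom0.of f) = Hom.lift f := by
  rw [Hom0.of, Hom0.lift_tmul, Rat.cast_one, one_smul]

theorem Hom0.lift_id (Λ : Submodule ℤ V) [DiscreteTopology Λ] :
    Hom0.lift (Hom0.id Λ) = ContinuousLinearMap.id ℂ V := by
  rw [Hom0.id, Hom0.lift_of]
  exact Hom.lift_ofLinear _ _

theorem Hom0.comp_add {Λ₁ : Submodule ℤ V} {Λ₂ : Submodule ℤ W} {Λ₃ : Submodule ℤ U}
    (h : Hom0 Λ₂ Λ₃) (f f' : Hom0 Λ₁ Λ₂) :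
    Hom0.comp h (f + f') = Hom0.comp h f + Hom0.comp h f' := map_add _ _ _

theorem Hom0.add_comp {Λ₁ : Submodule ℤ V} {Λ₂ : Submodule ℤ W} {Λ₃ : Submodule ℤ U}
    (h h' : Hom0 Λ₂ Λ₃) (f : Hom0 Λ₁ Λ₂) :
    Hom0.comp (h + h') f = Hom0.comp h f + Hom0.comp h' f := by
  unfold Hom0.comp
  rw [map_add, LinearMap.add_apply]

theorem Hom0.lift_comp {Λ₁ : Submodule ℤ V} {Λ₂ : Submodule ℤ W} {Λ₃ : Submodule ℤ U}
    [DiscreteTopology Λ₂] [DiscreteTopology Λ₃] (h : Hom0 Λ₂ Λ₃) (f : Hom0 Λ₁ Λ₂) :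
    Hom0.lift (Hom0.comp h f) = (Hom0.lift h).comp (Hom0.lift f) := by
  induction h using TensorProduct.induction_on with
  | zero => simp [Hom0.comp]
  | add h h' ih ih' => rw [Hom0.add_comp, map_add, ih, ih', map_add, ContinuousLinearMap.add_comp]
  | tmul p h =>
    induction f using TensorProduct.induction_on with
    | zero => simp [Hom0.comp]
    | add f f' ih ih' => rw [Hom0.comp_add, map_add, ih, ih', map_add, ContinuousLinearMap.comp_add]
    | tmul q f =>
      rw [Hom0.comp_tmul, Hom0.lift_tmul, Hom0.lift_tmul, Hom0.lift_tmul, Hom.lift_comp]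
      ext v
      simp [mul_smul, smul_comm (p : ℂ) (q : ℂ)]

theorem Hom0.lift_dual_apply {Λ : Submodule ℤ V} {Λ' : Submodule ℤ W} [DiscreteTopology Λ']
    [DiscreteTopology (dualLattice Λ)] (f : Hom0 Λ Λ') (l : W →L⋆[ℂ] ℂ) (v : V) :
    Hom0.lift (Hom0.dual f) l v = l (Hom0.lift f v) := by
  induction f using TensorProduct.induction_on with
  | zero => simp
  | add f f' ih ih' => simp [ih, ih']
  | tmul q f =>
    have h1 : Hom0.dual (q ⊗ₜ[ℤ] f) = q ⊗ₜ[ℤ] Hom.dual f := rfl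
    have h2 : Hom.lift (Hom.dual f) =
        (ContinuousLinearMap.compSL V W ℂ (RingHom.id ℂ) (starRingEnd ℂ)).flip (Hom.lift f) :=
      Hom.lift_eq _ _ fun _ => rfl
    rw [h1, Hom0.lift_tmul, Hom0.lift_tmul, h2]
    simp

/-- The bridge between the two representations: identities of `ℂ`-linear maps on `V` become
identities of matrices. -/
theorem ratRep_lift {ι : Type*} [Fintype ι] [DecidableEq ι] {Λ : Submodule ℤ V}
    [DiscreteTopology Λ] (b : Module.Basis ι ℤ Λ) (f : Hom0 Λ Λ) (j : ι) :
    Hom0.lift f (b j : V) = ∑ i, ((ratRep b f i j : ℚ) : ℝ) • (b i : V) := by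
  induction f using TensorProduct.induction_on with
  | zero => simp
  | add f f' ih ih' => simp [ih, ih', add_smul, Finset.sum_add_distrib]
  | tmul q f =>
    rw [ratRep_tmul, Hom0.lift_tmul]
    have h1 : Hom.lift f (b j : V) = ∑ i, (Hom.latticeMatrix b f i j) • (b i : V) := by
      have h2 : Hom.lift f (b j : V) = ((Hom.latticeMap f (b j) : Λ) : V) := rfl
      have h3 := congrArg (Λ.subtype) (b.sum_repr (Hom.latticeMap f (b j)))
      rw [h2]
      refine h3.symm.trans ?_
      rw [map_sum]
      refine Finset.sum_congr rfl fun i _ => ?_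
      rw [map_smul]
      have h4 : Hom.latticeMatrix b f i j = b.repr (Hom.latticeMap f (b j)) i :=
        LinearMap.toMatrix_apply b b _ i j
      rw [h4]
      rfl
    rw [_root_.smul_apply, h1, Finset.smul_sum]
    refine Finset.sum_congr rfl fun i _ => ?_
    rw [← Int.cast_smul_eq_zsmul ℂ, smul_smul, ← Complex.coe_smul]
    simp

end AnalyticRepresentation

/-! ### The inverse isogeny, and the Rosati involution as an adjoint. -/

section Rosati

variable {V : Type*} [NormedAddCommGroup V] [NormedSpace ℂ V] {Λ : Submodule ℤ V}

/-- `Im l` is `ℝ`-linear and a lattice basis spans `V` over `ℝ`, so `Im l = 0`; antilinearity then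
recovers `Re l(v)` as `-Im l(iv)`. -/
theorem eq_zero_of_im_apply_basis [FiniteDimensional ℂ V] {ι : Type*} [DiscreteTopology Λ] [IsZLattice ℝ Λ]
    (b : Module.Basis ι ℤ Λ) (l : V →L⋆[ℂ] ℂ) (h : ∀ i, (l (b i : V)).im = 0) : l = 0 := by
  have h0 : ∀ v, (l v).im = 0 := by
    intro v
    let B := b.ofZLatticeBasis ℝ Λ
    let φ : V →ₗ[ℝ] ℝ :=
      { toFun := fun v => (l v).im
        map_add' := fun u v => by simp
        map_smul' := fun c v => by
          rw [← Complex.coe_smul c v, ContinuousLinearMap.map_smulₛₗ]; simp }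
    have : φ = 0 := B.ext fun i => by
      simpa [φ, B, Module.Basis.ofZLatticeBasis_apply] using h i
    exact congrArg (fun ψ : V →ₗ[ℝ] ℝ => ψ v) this
  ext v
  have h1 := h0 (Complex.I • v)
  rw [ContinuousLinearMap.map_smulₛₗ] at h1
  exact Complex.ext (by simpa using h1) (by simpa using h0 v)

/-- Near zero, the imaginary parts on a lattice basis are integers of absolute value below `1`,
hence vanish. Discreteness is what gives homomorphisms into the dual torus a unique lift. -/
theorem discreteTopology_dualLattice [FiniteDimensional ℂ V] {ι : Type*} [Finite ι] [DiscreteTopology Λ] [IsZLattice ℝ Λ]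
    (b : Module.Basis ι ℤ Λ) : DiscreteTopology (dualLattice Λ) := by
  rw [discreteTopology_iff_isOpen_singleton_zero]
  have h1 : IsOpen {l : dualLattice Λ | ∀ i, ‖(l : V →L⋆[ℂ] ℂ) (b i : V)‖ < 1} := by
    rw [Set.ofPred_forall]
    refine isOpen_iInter_of_finite fun i => ?_
    refine isOpen_lt (Continuous.norm ?_) continuous_const
    exact (ContinuousLinearMap.apply' ℂ (starRingEnd ℂ) (b i : V)).continuous.comp
      continuous_subtype_val
  convert! h1
  ext l
  simp only [Set.mem_singleton_iff, Set.mem_ofPred_eq]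
  refine ⟨fun h i => by simp [h], fun h => Subtype.ext ?_⟩
  refine eq_zero_of_im_apply_basis b _ fun i => ?_
  obtain ⟨n, hn⟩ := l.2 (b i) (b i).2
  have h2 : |(n : ℝ)| < 1 := by
    rw [← hn]
    exact (Complex.abs_im_le_norm _).trans_lt (h i)
  have h3 : |n| < 1 := by exact_mod_cast h2
  rw [hn, Int.abs_lt_one_iff.1 h3, Int.cast_zero]

namespace Polarization

variable (L : Polarization Λ)

theorem form_injective : Function.Injective L.form := by
  rw [injective_iff_map_eq_zero]
  intro v hv
  by_contra h
  have := L.pos v h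
  simp [hv] at this

/-- A dimension count: evaluation at a basis embeds the antilinear functionals into `ℂ^(dim V)`, and
`H` embeds `V` into them by definiteness. -/
theorem exists_form_inverse [FiniteDimensional ℂ V] :
    ∃ G : (V →L⋆[ℂ] ℂ) →L[ℂ] V, (∀ v, G (L.form v) = v) ∧ ∀ l, L.form (G l) = l := by
  let e := Module.finBasis ℂ V
  let ev : (V →L⋆[ℂ] ℂ) →ₗ[ℂ] (Fin (Module.finrank ℂ V) → ℂ) :=
    LinearMap.pi fun i => (ContinuousLinearMap.apply' ℂ (starRingEnd ℂ) (e i)).toLinearMap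
  have hev : Function.Injective ev := by
    rw [injective_iff_map_eq_zero]
    intro l hl
    have h1 : ∀ i, l (e i) = 0 := fun i => congrFun hl i
    ext v
    rw [← e.sum_repr v, map_sum]
    simp only [ContinuousLinearMap.map_smulₛₗ, h1, smul_zero, Finset.sum_const_zero,
      _root_.zero_apply]
  have : FiniteDimensional ℂ (V →L⋆[ℂ] ℂ) := Module.Finite.of_injective ev hev
  have h1 : Module.finrank ℂ (V →L⋆[ℂ] ℂ) ≤ Module.finrank ℂ V := by
    simpa using LinearMap.finrank_le_finrank_of_injective hev
  have h2 : Module.finrank ℂ V ≤ Module.finrank ℂ (V →L⋆[ℂ] ℂ) :=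
    LinearMap.finrank_le_finrank_of_injective (f := L.form.toLinearMap) L.form_injective
  let Φ := LinearMap.linearEquivOfInjective L.form.toLinearMap L.form_injective
    (le_antisymm h2 h1)
  exact ⟨LinearMap.toContinuousLinearMap Φ.symm.toLinearMap, fun v => Φ.symm_apply_apply v,
    fun l => Φ.apply_symm_apply l⟩

variable {g : ℕ} {d : Fin g → ℕ} {b : Module.Basis (Fin g ⊕ Fin g) ℤ Λ}

theorem IsSymplecticBasis.imForm_inl_inl (h : L.IsSymplecticBasis d b) (i j : Fin g) :
    L.imForm (b (Sum.inl i)) (b (Sum.inl j)) = 0 :=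
  congrFun (congrFun h.gram (Sum.inl i)) (Sum.inl j)

theorem IsSymplecticBasis.imForm_inr_inr (h : L.IsSymplecticBasis d b) (i j : Fin g) :
    L.imForm (b (Sum.inr i)) (b (Sum.inr j)) = 0 :=
  congrFun (congrFun h.gram (Sum.inr i)) (Sum.inr j)

theorem IsSymplecticBasis.imForm_inl_inr (h : L.IsSymplecticBasis d b) (i j : Fin g) :
    L.imForm (b (Sum.inl i)) (b (Sum.inr j)) = if i = j then (d i : ℝ) else 0 :=
  (congrFun (congrFun h.gram (Sum.inl i)) (Sum.inr j)).trans
    (by rw [Matrix.fromBlocks_apply₁₂, Matrix.diagonal_apply])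

theorem IsSymplecticBasis.imForm_inr_inl (h : L.IsSymplecticBasis d b) (i j : Fin g) :
    L.imForm (b (Sum.inr i)) (b (Sum.inl j)) = -if i = j then (d i : ℝ) else 0 :=
  (congrFun (congrFun h.gram (Sum.inr i)) (Sum.inl j)).trans
    (by rw [Matrix.fromBlocks_apply₂₁, Matrix.neg_apply, Matrix.diagonal_apply])

theorem IsSymplecticBasis.imForm_eq (h : L.IsSymplecticBasis d b) (i j : Fin g ⊕ Fin g) :
    L.imForm (b i) (b j) =
      if j = i.swap then Sum.elim (fun k => (d k : ℝ)) (fun k => -(d k : ℝ)) i else 0 := by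
  rcases i with i | i <;> rcases j with j | j
  · simp [h.imForm_inl_inl]
  · simp [h.imForm_inl_inr, eq_comm]
  · simp only [h.imForm_inr_inl, Sum.swap_inr, Sum.inl.injEq, Sum.elim_inr, eq_comm (a := j)]
    split_ifs <;> simp
  · simp [h.imForm_inr_inr]

/-- Pairing `v` with the partner of a basis vector yields `±d_i` times a coordinate of `v`. These
are integers, so any common multiple of the `d_i` clears the denominators. -/
theorem IsSymplecticBasis.prod_smul_mem [DiscreteTopology Λ] [IsZLattice ℝ Λ]
    [FiniteDimensional ℂ V] (h : L.IsSymplecticBasis d b) (v : V)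
    (hv : ∀ x ∈ Λ, ∃ n : ℤ, (L.form v x).im = n) : (∏ i, d i) • v ∈ Λ := by
  let B := b.ofZLatticeBasis ℝ Λ
  have hB : ∀ i, B i = b i := fun i => b.ofZLatticeBasis_apply ℝ Λ i
  have hsum : v = ∑ i, B.repr v i • (b i : V) := by
    simpa only [hB] using (B.sum_repr v).symm
  have hdvd : ∀ i, ∃ m : ℕ, (∏ i, d i) = m * d i := fun i => by
    obtain ⟨m, hm⟩ := Finset.dvd_prod_of_mem d (Finset.mem_univ i)
    exact ⟨m, by rw [hm, mul_comm]⟩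
  have hcoord : ∀ i, ∃ n : ℤ, ((∏ i, d i : ℕ) : ℝ) * B.repr v i = n := by
    intro i
    rcases i with i | i
    · obtain ⟨n, hn⟩ := hv _ (b (Sum.inr i)).2
      obtain ⟨m, hm⟩ := hdvd i
      have h1 : L.imForm v (b (Sum.inr i)) = B.repr v (Sum.inl i) * d i := by
        conv_lhs => rw [hsum]
        simp [Fintype.sum_sum_type, h.imForm_inl_inr, h.imForm_inr_inr]
      rw [imForm_apply, hn] at h1
      refine ⟨m * n, ?_⟩
      rw [hm]
      push_cast
      rw [h1]
      ring
    · obtain ⟨n, hn⟩ := hv _ (b (Sum.inl i)).2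
      obtain ⟨m, hm⟩ := hdvd i
      have h1 : L.imForm v (b (Sum.inl i)) = -(B.repr v (Sum.inr i) * d i) := by
        conv_lhs => rw [hsum]
        simp [Fintype.sum_sum_type, h.imForm_inl_inl, h.imForm_inr_inl]
      rw [imForm_apply, hn] at h1
      refine ⟨-(m * n), ?_⟩
      rw [hm]
      push_cast
      rw [h1]
      ring
  choose n hn using hcoord
  have h2 : (∏ i, d i) • v = ∑ i, n i • (b i : V) := by
    conv_lhs => rw [hsum]
    rw [← Nat.cast_smul_eq_nsmul ℝ, Finset.smul_sum]
    refine Finset.sum_congr rfl fun i _ => ?_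
    rw [smul_smul, hn i, Int.cast_smul_eq_zsmul]
  rw [h2]
  exact Λ.sum_mem fun i _ => Λ.smul_mem _ (b i).2

/-- With `n = ∏ d_i`, the map `n Φ⁻¹` carries the dual lattice into `Λ`, and `n⁻¹ ⊗ n Φ⁻¹` inverts
`Φ`. Thus `isogenyInv` is the true inverse and not its default value `0`. -/
theorem IsSymplecticBasis.exists_isogeny_inverse [DiscreteTopology Λ] [IsZLattice ℝ Λ]
    [FiniteDimensional ℂ V] (h : L.IsSymplecticBasis d b) :
    ∃ Ψ : Hom0 (dualLattice Λ) Λ, Hom0.comp Ψ (Hom0.of L.isogeny) = Hom0.id Λ ∧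
      Hom0.comp (Hom0.of L.isogeny) Ψ = Hom0.id (dualLattice Λ) := by
  obtain ⟨G, hG1, hG2⟩ := L.exists_form_inverse
  have hn0 : ((∏ i, d i : ℕ) : ℚ) ≠ 0 := by
    exact_mod_cast (Finset.prod_pos fun i _ => h.pos i).ne'
  set n : ℕ := ∏ i, d i with hn
  have hmem : ∀ l ∈ dualLattice Λ, (n • G) l ∈ Λ := fun l hl => by
    refine h.prod_smul_mem L (G l) ?_
    rw [hG2]
    exact hl
  let K : Hom (dualLattice Λ) Λ := Hom.ofLinear (dualLattice Λ) Λ (n • G) hmem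
  have key : ∀ {X : Type _} [AddCommGroup X] (x : X),
      ((n : ℚ)⁻¹ ⊗ₜ[ℤ] (n • x) : ℚ ⊗[ℤ] X) = 1 ⊗ₜ[ℤ] x := by
    intro X _ x
    rw [← natCast_zsmul, ← TensorProduct.smul_tmul, natCast_zsmul, nsmul_eq_mul,
      mul_inv_cancel₀ hn0]
  refine ⟨(n : ℚ)⁻¹ ⊗ₜ[ℤ] K, ?_, ?_⟩
  · have h1 : Hom.comp K L.isogeny =
        n • Hom.ofLinear Λ Λ (ContinuousLinearMap.id ℂ V) fun _ hx => hx := by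
      refine Subtype.ext (AddMonoidHom.ext fun x => ?_)
      obtain ⟨v, rfl⟩ := Submodule.Quotient.mk_surjective _ x
      change Submodule.Quotient.mk (n • G (L.form v)) = n • Submodule.Quotient.mk v
      rw [hG1]
      exact map_nsmul Λ.mkQ n v
    rw [Hom0.of, Hom0.comp_tmul, mul_one, h1, key]
    rfl
  · have h1 : Hom.comp L.isogeny K = n • Hom.ofLinear (dualLattice Λ) (dualLattice Λ)
        (ContinuousLinearMap.id ℂ (V →L⋆[ℂ] ℂ)) fun _ hx => hx := by
      refine Subtype.ext (AddMonoidHom.ext fun x => ?_)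
      obtain ⟨l, rfl⟩ := Submodule.Quotient.mk_surjective _ x
      change Submodule.Quotient.mk (L.form (n • G l)) = n • Submodule.Quotient.mk l
      rw [map_nsmul, hG2]
      exact map_nsmul (dualLattice Λ).mkQ n l
    rw [Hom0.of, Hom0.comp_tmul, one_mul, h1, key]
    rfl

/-- This is `Φ f† = f̂ Φ`, evaluated at `u` and then at `v`. -/
theorem IsSymplecticBasis.form_lift_rosati [DiscreteTopology Λ] [IsZLattice ℝ Λ]
    [FiniteDimensional ℂ V] (h : L.IsSymplecticBasis d b) (f : Hom0 Λ Λ) (u v : V) :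
    L.form (Hom0.lift (L.rosati f) u) v = L.form u (Hom0.lift f v) := by
  have := discreteTopology_dualLattice b
  have hex := h.exists_isogeny_inverse
  have hΨ : Hom0.comp (Hom0.of L.isogeny) L.isogenyInv = Hom0.id (dualLattice Λ) := by
    rw [isogenyInv, dif_pos hex]
    exact hex.choose_spec.2
  have hΦ : Hom0.lift (Hom0.of L.isogeny) = L.form := by
    rw [Hom0.lift_of]
    exact Hom.lift_ofLinear _ _
  have h1 := congrArg Hom0.lift hΨ
  rw [Hom0.lift_comp, hΦ, Hom0.lift_id] at h1
  have h2 : Hom0.lift (L.rosati f) u =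
      Hom0.lift L.isogenyInv (Hom0.lift (Hom0.dual f) (L.form u)) := by
    rw [rosati, Hom0.lift_comp, Hom0.lift_comp, hΦ]
    rfl
  have h3 := congrArg (fun A => A (Hom0.lift (Hom0.dual f) (L.form u))) h1
  have h4 : L.form (Hom0.lift (L.rosati f) u) = Hom0.lift (Hom0.dual f) (L.form u) := by
    rw [h2]
    exact h3
  rw [h4, Hom0.lift_dual_apply]

end Polarization

end Rosati

end ComplexTorus

theorem abs_le_supNorm {m n : Type*} [Fintype m] [Fintype n] (M : Matrix m n ℝ) (i : m) (j : n) :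
    |M i j| ≤ supNorm M :=
  norm_le_pi_norm (fun p : m × n => M p.1 p.2) (i, j)

theorem supNorm_nonneg {m n : Type*} [Fintype m] [Fintype n] (M : Matrix m n ℝ) :
    0 ≤ supNorm M := norm_nonneg _

theorem supNorm_le {m n : Type*} [Fintype m] [Fintype n] {M : Matrix m n ℝ} {c : ℝ} (hc : 0 ≤ c)
    (h : ∀ i j, |M i j| ≤ c) : supNorm M ≤ c :=
  (pi_norm_le_iff_of_nonneg hc).2 fun p => h p.1 p.2

/-! ### Operator norm against Hilbert-Schmidt norm. -/

namespace Matrix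

variable {n : Type*} [Fintype n]

/-- The trace is the sum of the squared entries of `P`; Cauchy-Schwarz applies to each row. -/
theorem dotProduct_mulVec_self_le_trace (P : Matrix n n ℝ) (y : n → ℝ) :
    (P *ᵥ y) ⬝ᵥ (P *ᵥ y) ≤ (Pᵀ * P).trace * (y ⬝ᵥ y) := by
  have h1 : (Pᵀ * P).trace = ∑ i, ∑ j, P i j ^ 2 := by
    rw [Finset.sum_comm]
    simp [Matrix.trace, Matrix.mul_apply, sq]
  rw [h1, Finset.sum_mul]
  refine Finset.sum_le_sum fun i _ => ?_
  have := Finset.sum_mul_sq_le_sq_mul_sq Finset.univ (fun j => P i j) y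
  simpa [Matrix.mulVec, dotProduct, sq] using this

open scoped MatrixOrder in
/-- If `M'` is adjoint to `M` for a positive definite form `S`, then the operator norm of `M` for
`S` is at most its Hilbert-Schmidt norm. -/
theorem PosDef.mulVec_le_trace [DecidableEq n] {S : Matrix n n ℝ} (hS : S.PosDef) {M M' : Matrix n n ℝ}
    (h : S * M' = Mᵀ * S) (x : n → ℝ) :
    (M *ᵥ x) ⬝ᵥ (S *ᵥ (M *ᵥ x)) ≤ (M' * M).trace * (x ⬝ᵥ (S *ᵥ x)) := by
  -- In the coordinates `B x` the form `S` becomes the standard one, `M` becomes `P = B M B⁻¹`, and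
  -- its adjoint `M'` becomes `Pᵀ`.
  obtain ⟨B, hB, hSB⟩ : ∃ B : Matrix n n ℝ, IsUnit B ∧ S = Bᵀ * B := by
    obtain ⟨B, hB⟩ := CStarAlgebra.nonneg_iff_eq_star_mul_self.mp hS.posSemidef.nonneg
    refine ⟨B, ?_, hB⟩
    have h1 := hS.isUnit
    rw [hB, Matrix.isUnit_iff_isUnit_det, Matrix.det_mul] at h1
    exact (Matrix.isUnit_iff_isUnit_det B).2 (isUnit_of_mul_isUnit_right h1)
  have hd : IsUnit B.det := (Matrix.isUnit_iff_isUnit_det B).1 hB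
  have hq : ∀ z : n → ℝ, z ⬝ᵥ (S *ᵥ z) = (B *ᵥ z) ⬝ᵥ (B *ᵥ z) := by
    intro z
    rw [hSB, ← Matrix.mulVec_mulVec, Matrix.dotProduct_mulVec, Matrix.vecMul_transpose]
  have hP : B *ᵥ (M *ᵥ x) = (B * M * B⁻¹) *ᵥ (B *ᵥ x) := by
    rw [Matrix.mulVec_mulVec, Matrix.mulVec_mulVec, Matrix.mul_assoc, Matrix.nonsing_inv_mul _ hd,
      Matrix.mul_one]
  have htr : ((B * M * B⁻¹)ᵀ * (B * M * B⁻¹)).trace = (M' * M).trace := by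
    have hM' : M' = B⁻¹ * (B⁻¹)ᵀ * (Mᵀ * S) := by
      rw [← h, hSB]
      have h1 : (B⁻¹)ᵀ * Bᵀ = 1 := by
        rw [← Matrix.transpose_mul, Matrix.mul_nonsing_inv _ hd, Matrix.transpose_one]
      calc M' = B⁻¹ * (((B⁻¹)ᵀ * Bᵀ) * (B * M')) := by
            rw [h1, Matrix.one_mul, ← Matrix.mul_assoc, Matrix.nonsing_inv_mul _ hd, Matrix.one_mul]
        _ = _ := by simp only [Matrix.mul_assoc]
    rw [← Matrix.mul_assoc, Matrix.trace_mul_comm, hM', hSB]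
    simp only [Matrix.transpose_mul, Matrix.mul_assoc]
  rw [hq, hq, hP, ← htr]
  exact dotProduct_mulVec_self_le_trace _ _

end Matrix

/-! ### Entries of the rational representation against the Rosati trace. -/

namespace ComplexTorus

variable {V : Type*} [NormedAddCommGroup V] [NormedSpace ℂ V] {Λ : Submodule ℤ V}

/-- The Gram matrix of the real part of the polarization. -/
noncomputable def Polarization.gram (L : Polarization Λ) {ι : Type*} (b : Module.Basis ι ℤ Λ) : Matrix ι ι ℝ :=
  Matrix.of fun i j => L.reForm (b i) (b j)

theorem Polarization.dotProduct_gram_mulVec (L : Polarization Λ) {ι : Type*} [Fintype ι] (b : Module.Basis ι ℤ Λ) (x y : ι → ℝ) :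
    x ⬝ᵥ (L.gram b *ᵥ y) = L.reForm (∑ i, x i • (b i : V)) (∑ i, y i • (b i : V)) := by
  simp only [dotProduct, mulVec, gram, Matrix.of_apply, map_sum, LinearMap.sum_apply,
    map_smul, LinearMap.smul_apply, smul_eq_mul, Finset.mul_sum]
  rw [Finset.sum_comm]
  refine Finset.sum_congr rfl fun i _ => Finset.sum_congr rfl fun j _ => by ring

variable [DiscreteTopology Λ]

/-- The rational representation with real entries. -/
noncomputable def realRep {ι : Type*} [Fintype ι] [DecidableEq ι] (b : Module.Basis ι ℤ Λ) (f : Hom0 Λ Λ) : Matrix ι ι ℝ := (ratRep b f).map (Rat.cast : ℚ → ℝ)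

theorem lift_basis {ι : Type*} [Fintype ι] [DecidableEq ι] (b : Module.Basis ι ℤ Λ) (f : Hom0 Λ Λ) (j : ι) :
    Hom0.lift f (b j : V) = ∑ i, realRep b f i j • (b i : V) := ratRep_lift b f j

theorem Polarization.IsSymplecticBasis.imForm_lift (L : Polarization Λ) {g : ℕ} {d : Fin g → ℕ}
    {b : Module.Basis (Fin g ⊕ Fin g) ℤ Λ} (h : L.IsSymplecticBasis d b)
    (f : Hom0 Λ Λ) (j k : Fin g ⊕ Fin g) :
    L.imForm (b j) (Hom0.lift f (b k)) = realRep b f j.swap k *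
      Sum.elim (fun k => (d k : ℝ)) (fun k => -(d k : ℝ)) j := by
  rw [lift_basis b]
  simp only [map_sum, map_smul, h.imForm_eq, smul_eq_mul, mul_ite, mul_zero, Finset.sum_ite_eq',
    Finset.mem_univ, if_true]

variable [IsZLattice ℝ Λ] [FiniteDimensional ℂ V]

theorem linearIndependent_basis {ι : Type*} (b : Module.Basis ι ℤ Λ) : LinearIndependent ℝ fun i => (b i : V) := by
  have h := (b.ofZLatticeBasis ℝ Λ).linearIndependent
  have h2 : ⇑(b.ofZLatticeBasis ℝ Λ) = fun i => (b i : V) :=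
    funext fun i => b.ofZLatticeBasis_apply ℝ Λ i
  rwa [h2] at h

section RealRep

variable {ι : Type*} [Fintype ι] (b : Module.Basis ι ℤ Λ)

theorem matrix_eq_of_sum_smul_eq {A B : Matrix ι ι ℝ}
    (h : ∀ j, ∑ i, A i j • (b i : V) = ∑ i, B i j • (b i : V)) : A = B := by
  ext i j
  have h1 : ∑ i, (A i j - B i j) • (b i : V) = 0 := by
    simp only [sub_smul, Finset.sum_sub_distrib, h j, sub_self]
  exact sub_eq_zero.1 (Fintype.linearIndependent_iff.1 (linearIndependent_basis b) _ h1 i)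

variable [DecidableEq ι]

theorem realRep_comp (h f : Hom0 Λ Λ) :
    realRep b (Hom0.comp h f) = realRep b h * realRep b f := by
  refine matrix_eq_of_sum_smul_eq b fun j => ?_
  rw [← lift_basis, Hom0.lift_comp, ContinuousLinearMap.comp_apply, lift_basis, map_sum]
  have h1 : ∀ (c : ℝ) (v : V), Hom0.lift h (c • v) = c • Hom0.lift h v := fun c v => by
    rw [← Complex.coe_smul c v, map_smul, Complex.coe_smul]
  simp only [h1, lift_basis, Finset.smul_sum, smul_smul, Matrix.mul_apply, Finset.sum_smul]
  rw [Finset.sum_comm]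
  simp only [mul_comm]

theorem trace_ratRep_comp (h f : Hom0 Λ Λ) :
    (((ratRep b (Hom0.comp h f)).trace : ℚ) : ℝ) = (realRep b h * realRep b f).trace := by
  rw [← realRep_comp]
  simp [Matrix.trace, realRep]

end RealRep

namespace Polarization

variable (L : Polarization Λ) {g : ℕ} {d : Fin g → ℕ} {b : Module.Basis (Fin g ⊕ Fin g) ℤ Λ}

/-- Adjointness for `E`: each basis vector pairs nontrivially only with its partner, so each side of
`E(f† λ_j, λ_k) = E(λ_j, f λ_k)` is a single entry times `±d`. -/
theorem IsSymplecticBasis.abs_rosati_mul (h : L.IsSymplecticBasis d b) (f : Hom0 Λ Λ)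
    (j k : Fin g ⊕ Fin g) :
    |realRep b (L.rosati f) k.swap j| * Sum.elim d d k =
      |realRep b f j.swap k| * Sum.elim d d j := by
  have h1 : L.imForm (Hom0.lift (L.rosati f) (b j)) (b k) = L.imForm (b j) (Hom0.lift f (b k)) :=
    congrArg Complex.im (h.form_lift_rosati L f _ _)
  have h2 : L.imForm (Hom0.lift (L.rosati f) (b j)) (b k) =
      realRep b (L.rosati f) k.swap j *
        Sum.elim (fun k => (d k : ℝ)) (fun k => -(d k : ℝ)) k.swap := by
    rw [lift_basis b]
    simp only [map_sum, map_smul, LinearMap.sum_apply, LinearMap.smul_apply, h.imForm_eq,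
      smul_eq_mul]
    rw [Finset.sum_eq_single k.swap]
    · simp
    · intro i _ hi
      rw [if_neg, mul_zero]
      rintro rfl
      simp at hi
    · simp
  have h3 : L.imForm (b j) (Hom0.lift f (b k)) = realRep b f j.swap k *
        Sum.elim (fun k => (d k : ℝ)) (fun k => -(d k : ℝ)) j := by
    exact h.imForm_lift L f j k
  rw [h2, h3] at h1
  have h4 := congrArg abs h1
  rw [abs_mul, abs_mul] at h4
  rcases j with j | j <;> rcases k with k | k <;> simpa using h4

theorem IsSymplecticBasis.trace_rosati_le (h : L.IsSymplecticBasis d b) (f : Hom0 Λ Λ) {c : ℝ}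
    (hc : ∀ i j, (d i : ℝ) / d j ≤ c) :
    (realRep b (L.rosati f) * realRep b f).trace ≤
      (2 * g) ^ 2 * c * supNorm (realRep b f) ^ 2 := by
  have hd : ∀ i : Fin g ⊕ Fin g, (0 : ℝ) < (Sum.elim d d i : ℕ) := by
    rintro (i | i) <;> exact_mod_cast h.pos i
  have hc' : ∀ i j : Fin g ⊕ Fin g, ((Sum.elim d d i : ℕ) : ℝ) / (Sum.elim d d j : ℕ) ≤ c := by
    rintro (i | i) (j | j) <;> exact hc i j
  have key : ∀ i j, |realRep b (L.rosati f) i j| ≤ c * supNorm (realRep b f) := by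
    intro i j
    have h1 := h.abs_rosati_mul L f j i.swap
    rw [Sum.swap_swap] at h1
    have h2 : |realRep b (L.rosati f) i j| =
        ((Sum.elim d d j : ℕ) : ℝ) / (Sum.elim d d i.swap : ℕ) * |realRep b f j.swap i.swap| := by
      rw [div_mul_eq_mul_div, eq_div_iff (hd _).ne', h1, mul_comm]
    rw [h2]
    exact mul_le_mul (hc' _ _) (abs_le_supNorm _ _ _) (abs_nonneg _)
      ((div_pos (hd j) (hd j)).le.trans (hc' j j))
  calc (realRep b (L.rosati f) * realRep b f).trace
      = ∑ i, ∑ j, realRep b (L.rosati f) i j * realRep b f j i := by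
        simp [Matrix.trace, Matrix.mul_apply]
    _ ≤ ∑ _i : Fin g ⊕ Fin g, ∑ _j : Fin g ⊕ Fin g, c * supNorm (realRep b f) ^ 2 := by
        refine Finset.sum_le_sum fun i _ => Finset.sum_le_sum fun j _ => ?_
        refine (le_abs_self _).trans ?_
        rw [abs_mul, sq, ← mul_assoc]
        exact mul_le_mul (key i j) (abs_le_supNorm _ _ _) (abs_nonneg _)
          ((abs_nonneg _).trans (key i j))
    _ = _ := by
        simp only [Finset.sum_const, Finset.card_univ, Fintype.card_sum, Fintype.card_fin,
          nsmul_eq_mul]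
        push_cast
        ring

theorem gram_posDef {ι : Type*} [Fintype ι] [DecidableEq ι] (b : Module.Basis ι ℤ Λ) :
    (L.gram b).PosDef := by
  refine Matrix.PosDef.of_dotProduct_mulVec_pos ?_ fun x hx => ?_
  · ext i j
    exact L.reForm_comm _ _
  · rw [star_trivial, dotProduct_gram_mulVec]
    refine L.pos _ fun h0 => hx ?_
    exact funext (Fintype.linearIndependent_iff.1 (linearIndependent_basis b) x h0)

/-- Adjointness for `Re H` is the hypothesis of `PosDef.mulVec_le_trace` for the Gram matrix. -/
theorem IsSymplecticBasis.reForm_lift_le (h : L.IsSymplecticBasis d b) (f : Hom0 Λ Λ)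
    (j : Fin g ⊕ Fin g) :
    L.reForm (Hom0.lift f (b j)) (Hom0.lift f (b j)) ≤
      (realRep b (L.rosati f) * realRep b f).trace * L.reForm (b j) (b j) := by
  have hadj : L.gram b * realRep b (L.rosati f) = (realRep b f)ᵀ * L.gram b := by
    ext j k
    have h1 : L.reForm (Hom0.lift (L.rosati f) (b k)) (b j) = L.reForm (b k) (Hom0.lift f (b j)) :=
      congrArg Complex.re (h.form_lift_rosati L f _ _)
    rw [L.reForm_comm, L.reForm_comm _ (Hom0.lift f (b j)), lift_basis b, lift_basis b] at h1
    simp only [map_sum, map_smul, LinearMap.sum_apply, LinearMap.smul_apply, smul_eq_mul] at h1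
    rw [Matrix.mul_apply, Matrix.mul_apply]
    refine Eq.trans (Finset.sum_congr rfl fun i _ => mul_comm _ _) h1
  have h2 := (L.gram_posDef b).mulVec_le_trace hadj (Pi.single j 1)
  rw [L.dotProduct_gram_mulVec, L.dotProduct_gram_mulVec] at h2
  simpa [lift_basis b, Pi.single_apply] using h2

theorem IsSymplecticBasis.trace_rosati_nonneg (h : L.IsSymplecticBasis d b) (f : Hom0 Λ Λ)
    (hg : 0 < g) : 0 ≤ (realRep b (L.rosati f) * realRep b f).trace := by
  let j : Fin g ⊕ Fin g := Sum.inl ⟨0, hg⟩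
  have h1 := (L.reForm_self_nonneg _).trans (h.reForm_lift_le L f j)
  refine nonneg_of_mul_nonneg_left h1 (L.pos _ ?_)
  exact (linearIndependent_basis b).ne_zero j

/-- Pairing `f λ_j` with the partner of `λ_i` isolates the entry `(i, j)` up to a factor `±d_k`.
Cauchy-Schwarz and `reForm_lift_le` bound that pairing. -/
theorem IsSymplecticBasis.supNorm_realRep_le (h : L.IsSymplecticBasis d b) (f : Hom0 Λ Λ)
    (hg : 0 < g) {c : ℝ} (hc : ∀ j, L.reForm (b j) (b j) ≤ c) :
    supNorm (realRep b f) ≤ c * √(realRep b (L.rosati f) * realRep b f).trace := by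
  have htr := h.trace_rosati_nonneg L f hg
  set T := (realRep b (L.rosati f) * realRep b f).trace with hT
  have hc0 : 0 ≤ c := (L.reForm_self_nonneg _).trans (hc (Sum.inl ⟨0, hg⟩))
  refine supNorm_le (mul_nonneg hc0 (Real.sqrt_nonneg _)) fun i j => ?_
  have h1 : L.imForm (b i.swap) (Hom0.lift f (b j)) = realRep b f i j *
        Sum.elim (fun k => (d k : ℝ)) (fun k => -(d k : ℝ)) i.swap := by
    simpa using h.imForm_lift L f i.swap j
  have h2 : |realRep b f i j| ≤ |L.imForm (b i.swap) (Hom0.lift f (b j))| := by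
    rw [h1, abs_mul]
    -- Dropping the factor `d_k ≥ 1` only weakens the bound.
    refine le_mul_of_one_le_right (abs_nonneg _) ?_
    rcases i with i | i <;> simp [Nat.one_le_iff_ne_zero, (h.pos i).ne']
  refine h2.trans (abs_le_of_sq_le_sq ?_ (mul_nonneg hc0 (Real.sqrt_nonneg _)))
  calc L.imForm (b i.swap) (Hom0.lift f (b j)) ^ 2
      ≤ L.reForm (b i.swap) (b i.swap) * L.reForm (Hom0.lift f (b j)) (Hom0.lift f (b j)) :=
        L.imForm_sq_le _ _
    _ ≤ c * (T * c) := by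
        refine mul_le_mul (hc _) ?_ (L.reForm_self_nonneg _) hc0
        exact (h.reForm_lift_le L f j).trans (mul_le_mul_of_nonneg_left (hc j) htr)
    _ = (c * √T) ^ 2 := by
        rw [mul_pow, Real.sq_sqrt htr]
        ring

end Polarization

end ComplexTorus

/-! ### From integral vectors to real ones by Diophantine approximation. -/

/-- Simultaneous Diophantine approximation. -/
theorem exists_nat_mul_sub_int_abs_lt {ι : Type*} [Fintype ι] (x : ι → ℝ) {Q : ℕ} (hQ : 0 < Q) :
    ∃ q : ℕ, 0 < q ∧ q ≤ Q ^ Fintype.card ι ∧ ∃ a : ι → ℤ, ∀ i, |q * x i - a i| < 1 / Q := by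
  classical
  have hQ' : (0 : ℝ) < Q := by exact_mod_cast hQ
  have hlt : ∀ y : ℝ, ⌊Q * Int.fract y⌋₊ < Q := fun y => by
    rw [Nat.floor_lt (by positivity)]
    exact mul_lt_of_lt_one_right hQ' (Int.fract_lt_one y)
  -- Pigeonhole: the multiples `0, …, Q^n` of `x`, taken modulo `1`, fall into `Q^n` cubes of side
  -- `1/Q`.
  let box : Fin (Q ^ Fintype.card ι + 1) → ι → Fin Q := fun q i =>
    ⟨⌊Q * Int.fract ((q : ℕ) * x i)⌋₊, hlt _⟩
  obtain ⟨q₁, q₂, hne, heq⟩ := Fintype.exists_ne_map_eq_of_card_lt box (by simp)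
  wlog h : q₁ < q₂ generalizing q₁ q₂
  · exact this q₂ q₁ hne.symm heq.symm (lt_of_le_of_ne (not_lt.1 h) hne.symm)
  refine ⟨(q₂ : ℕ) - q₁, Nat.sub_pos_of_lt h, by have := q₂.2; omega,
    fun i => ⌊((q₂ : ℕ) : ℝ) * x i⌋ - ⌊((q₁ : ℕ) : ℝ) * x i⌋, fun i => ?_⟩
  have h1 : ⌊Q * Int.fract (((q₁ : ℕ) : ℝ) * x i)⌋₊ = ⌊Q * Int.fract (((q₂ : ℕ) : ℝ) * x i)⌋₊ :=
    congrArg Fin.val (congrFun heq i)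
  have h2 : |Q * Int.fract (((q₂ : ℕ) : ℝ) * x i) - Q * Int.fract (((q₁ : ℕ) : ℝ) * x i)| < 1 := by
    have a1 := Nat.floor_le (a := Q * Int.fract (((q₁ : ℕ) : ℝ) * x i)) (by positivity)
    have a2 := Nat.floor_le (a := Q * Int.fract (((q₂ : ℕ) : ℝ) * x i)) (by positivity)
    have b1 := Nat.lt_floor_add_one (Q * Int.fract (((q₁ : ℕ) : ℝ) * x i))
    have b2 := Nat.lt_floor_add_one (Q * Int.fract (((q₂ : ℕ) : ℝ) * x i))
    rw [h1] at a1 b1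
    rw [abs_lt]
    constructor <;> linarith
  rw [← mul_sub, abs_mul, abs_of_pos hQ', mul_comm, ← lt_div_iff₀ hQ'] at h2
  convert! h2 using 2
  rw [Nat.cast_sub h.le, Int.fract, Int.fract]
  push_cast
  ring

namespace Matrix

variable {n : Type*} [Fintype n] {Y : Matrix n n ℝ}

theorem PosSemidef.form_nonneg (hY : Y.PosSemidef) (x : n → ℝ) : 0 ≤ x ⬝ᵥ (Y *ᵥ x) := by
  simpa using hY.dotProduct_mulVec_nonneg x

theorem PosSemidef.form_add_le (hY : Y.PosSemidef) (u v : n → ℝ) :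
    (u + v) ⬝ᵥ (Y *ᵥ (u + v)) ≤ 2 * (u ⬝ᵥ (Y *ᵥ u)) + 2 * (v ⬝ᵥ (Y *ᵥ v)) := by
  have h := hY.form_nonneg (u - v)
  simp only [mulVec_add, mulVec_sub, add_dotProduct, sub_dotProduct, dotProduct_add,
    dotProduct_sub] at h ⊢
  linarith

theorem form_smul (c : ℝ) (x : n → ℝ) : (c • x) ⬝ᵥ (Y *ᵥ (c • x)) = c ^ 2 * (x ⬝ᵥ (Y *ᵥ x)) := by
  rw [mulVec_smul, smul_dotProduct, dotProduct_smul, smul_eq_mul, smul_eq_mul]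
  ring

theorem form_le_of_abs_le {T ε : ℝ} (hT : ∀ i j, |Y i j| ≤ T) {w : n → ℝ} (hw : ∀ i, |w i| ≤ ε) :
    w ⬝ᵥ (Y *ᵥ w) ≤ (Fintype.card n : ℝ) ^ 2 * T * ε ^ 2 := by
  have h1 : ∀ i j, w i * (Y i j * w j) ≤ T * ε ^ 2 := by
    intro i j
    refine (le_abs_self _).trans ?_
    rw [abs_mul, abs_mul]
    have hε := (abs_nonneg _).trans (hw i)
    have hT0 := (abs_nonneg _).trans (hT i j)
    calc |w i| * (|Y i j| * |w j|) ≤ ε * (T * ε) :=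
          mul_le_mul (hw i) (mul_le_mul (hT i j) (hw j) (abs_nonneg _) hT0)
            (mul_nonneg (abs_nonneg _) (abs_nonneg _)) hε
      _ = T * ε ^ 2 := by ring
  calc w ⬝ᵥ (Y *ᵥ w) = ∑ i, ∑ j, w i * (Y i j * w j) := by
        simp [dotProduct, mulVec, Finset.mul_sum]
    _ ≤ ∑ _i : n, ∑ _j : n, T * ε ^ 2 :=
        Finset.sum_le_sum fun i _ => Finset.sum_le_sum fun j _ => h1 i j
    _ = _ := by
        simp only [Finset.sum_const, Finset.card_univ, nsmul_eq_mul]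
        ring

/-- Nonnegativity on `e_i ± e_j` gives `2 |Y_ij| ≤ Y_ii + Y_jj`. -/
theorem PosSemidef.abs_apply_le [DecidableEq n] (hY : Y.PosSemidef) {T : ℝ}
    (hT : ∀ i, Y i i ≤ T) (i j : n) : |Y i j| ≤ T := by
  have hs : Y j i = Y i j := by simpa using hY.isHermitian.apply i j
  have h1 := hY.form_nonneg (Pi.single i 1 + Pi.single j 1)
  have h2 := hY.form_nonneg (Pi.single i 1 - Pi.single j 1)
  simp only [mulVec_add, mulVec_sub, add_dotProduct, sub_dotProduct, dotProduct_add,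
    dotProduct_sub, mulVec_single_one, single_one_dotProduct, Matrix.col_apply, hs] at h1 h2
  have := hT i
  have := hT j
  rw [abs_le]
  constructor <;> linarith

/-- If a form is bounded below on nonzero integral vectors, it is bounded below on real vectors. -/
theorem PosSemidef.sq_le_form (hY : Y.PosSemidef)
    (hmin : ∀ a : n → ℤ, a ≠ 0 → 3 / 4 ≤ (fun i => (a i : ℝ)) ⬝ᵥ (Y *ᵥ fun i => (a i : ℝ)))
    {T : ℝ} (hT1 : 1 ≤ T) (hT : ∀ i j, |Y i j| ≤ T) (x : n → ℝ) (i : n) :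
    x i ^ 2 ≤ 4 * ((3 * Fintype.card n * ⌈T⌉₊ : ℕ) : ℝ) ^ (2 * Fintype.card n) *
      (x ⬝ᵥ (Y *ᵥ x)) := by
  have hn : 0 < Fintype.card n := Fintype.card_pos_iff.2 ⟨i⟩
  -- This size makes the form of the approximation error at most `n² T / Q² ≤ 1/9 < 1/8`.
  set Q : ℕ := 3 * Fintype.card n * ⌈T⌉₊ with hQdef
  have hceil : 1 ≤ ⌈T⌉₊ := Nat.one_le_iff_ne_zero.2 (Nat.ceil_pos.2 (by linarith)).ne'
  have hQ : 0 < Q := by positivity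
  have hQ3 : 3 ≤ Q := by
    rw [hQdef, mul_assoc]
    exact Nat.le_mul_of_pos_right 3 (by positivity)
  have hQ' : (0 : ℝ) < Q := by exact_mod_cast hQ
  by_cases hx : x i = 0
  · rw [hx, zero_pow two_ne_zero]
    have := hY.form_nonneg x
    positivity
  -- After scaling to `x_i = 1`, the `i`-th coordinate of the approximated vector is `q ≥ 1`; this
  -- forces `a ≠ 0`.
  obtain ⟨q, hq0, hqQ, a, ha⟩ := exists_nat_mul_sub_int_abs_lt ((x i)⁻¹ • x) hQ
  have hq0' : (1 : ℝ) ≤ q := by exact_mod_cast hq0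
  have ha0 : a ≠ 0 := by
    rintro rfl
    have h1 := ha i
    have h3 : (1 : ℝ) / Q ≤ 1 := by
      rw [div_le_one hQ']
      exact_mod_cast hQ
    simp [hx] at h1
    rw [one_div] at h3
    linarith
  set r : n → ℝ := fun j => (a j : ℝ) - q * ((x i)⁻¹ • x) j with hr
  have hr1 : ∀ j, |r j| ≤ 1 / Q := fun j => by
    rw [hr, abs_sub_comm]
    exact (ha j).le
  have hsum : (fun j => (a j : ℝ)) = (q : ℝ) • ((x i)⁻¹ • x) + r := by
    ext j
    simp [hr]
  have h1 := hmin a ha0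
  rw [hsum] at h1
  have h2 := hY.form_add_le ((q : ℝ) • ((x i)⁻¹ • x)) r
  rw [form_smul, form_smul] at h2
  have h3 := form_le_of_abs_le hT hr1
  have h4 : (Fintype.card n : ℝ) ^ 2 * T * (1 / Q) ^ 2 ≤ 1 / 8 := by
    have hTc : T ≤ ⌈T⌉₊ := Nat.le_ceil T
    have hc1 : (1 : ℝ) ≤ ⌈T⌉₊ := by exact_mod_cast hceil
    rw [one_div, inv_pow, ← div_eq_mul_inv, div_le_iff₀ (by positivity), hQdef]
    push_cast
    have : T ≤ (⌈T⌉₊ : ℝ) ^ 2 := by nlinarith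
    have hc2 : (0 : ℝ) ≤ (Fintype.card n : ℝ) ^ 2 := by positivity
    nlinarith [mul_le_mul_of_nonneg_left this hc2]
  have h5 : (q : ℝ) ^ 2 ≤ (Q : ℝ) ^ (2 * Fintype.card n) := by
    rw [mul_comm 2, pow_mul]
    exact pow_le_pow_left₀ (by positivity) (by exact_mod_cast hqQ) 2
  -- From `3/4 ≤ Y[a] ≤ 2 q² Y[x] / x_i² + 2 · 1/8`.
  have h6 : 1 ≤ 4 * ((q : ℝ) ^ 2 * ((x i)⁻¹ ^ 2 * (x ⬝ᵥ (Y *ᵥ x)))) := by linarith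
  have h7 : x i ^ 2 ≤ 4 * ((q : ℝ) ^ 2 * (x ⬝ᵥ (Y *ᵥ x))) := by
    have h8 := mul_le_mul_of_nonneg_left h6 (sq_nonneg (x i))
    have h9 : x i ^ 2 * (4 * ((q : ℝ) ^ 2 * ((x i)⁻¹ ^ 2 * (x ⬝ᵥ (Y *ᵥ x))))) =
        4 * ((q : ℝ) ^ 2 * (x ⬝ᵥ (Y *ᵥ x))) := by
      field_simp
    linarith
  have h10 := mul_le_mul_of_nonneg_right h5 (hY.form_nonneg x)
  linarith

end Matrix

/-! ### Minkowski reduction and the fundamental domain. -/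

namespace Siegel

variable {g : ℕ} {Y : Matrix (Fin g) (Fin g) ℝ}

/-- For the first index the gcd condition is primitivity, and dividing `a` by its content `p`
divides the form by `p² ≥ 1`. -/
theorem IsMinkowskiReduced.apply_zero_le (h : IsMinkowskiReduced Y) (hg : 0 < g)
    (h0 : 0 ≤ Y ⟨0, hg⟩ ⟨0, hg⟩) (a : Fin g → ℤ) (ha : a ≠ 0) :
    Y ⟨0, hg⟩ ⟨0, hg⟩ ≤ (fun i => (a i : ℝ)) ⬝ᵥ (Y *ᵥ fun i => (a i : ℝ)) := by
  have hf : Finset.univ.filter ((⟨0, hg⟩ : Fin g) ≤ ·) = Finset.univ :=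
    Finset.filter_true_of_mem fun i _ => Nat.zero_le i.1
  obtain ⟨c, hc, hc1⟩ := Finset.extract_gcd a (s := Finset.univ) ⟨⟨0, hg⟩, Finset.mem_univ _⟩
  set p := Finset.univ.gcd a
  have hp : p ≠ 0 := by
    intro hp
    refine ha (funext fun i => ?_)
    rw [hc i (Finset.mem_univ i), hp, zero_mul]
    rfl
  have h1 := h.1 ⟨0, hg⟩ c (by rw [hf, hc1])
  have h2 : (fun i => (a i : ℝ)) = (p : ℝ) • fun i => (c i : ℝ) := by
    ext i
    rw [hc i (Finset.mem_univ i)]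
    simp
  rw [h2, Matrix.form_smul]
  have h3 : (1 : ℝ) ≤ (p : ℝ) ^ 2 := by
    have : (1 : ℤ) ≤ p ^ 2 := Int.add_one_le_iff.2 (sq_pos_of_ne_zero hp)
    exact_mod_cast this
  nlinarith

/-- Diagonal entries of Minkowski reduced forms are bounded by the successive minima. -/
theorem IsMinkowskiReduced.apply_self_le (h : IsMinkowskiReduced Y) (hY : Y.PosSemidef) {R : ℝ}
    (hR : 0 ≤ R) (hex : ∀ k : Fin g, ∃ a : Fin g → ℤ,
      (fun i => (a i : ℝ)) ⬝ᵥ (Y *ᵥ fun i => (a i : ℝ)) ≤ R ∧ ∃ i, k ≤ i ∧ a i ≠ 0)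
    (m : ℕ) (hm : m < g) : Y ⟨m, hm⟩ ⟨m, hm⟩ ≤ 2 * R * (1 + g) ^ m := by
  induction m using Nat.strong_induction_on with
  | _ m ih =>
  set k : Fin g := ⟨m, hm⟩ with hk
  obtain ⟨a, haR, i₀, hi₀, hai₀⟩ := hex k
  have hmem : i₀ ∈ Finset.univ.filter (k ≤ ·) := by simp [hi₀]
  obtain ⟨c, hc, hc1⟩ := Finset.extract_gcd a ⟨i₀, hmem⟩
  set p := (Finset.univ.filter (k ≤ ·)).gcd a
  have hp : p ≠ 0 := by
    intro hp
    apply hai₀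
    rw [hc i₀ hmem, hp, zero_mul]
  have hp' : (p : ℝ) ≠ 0 := by exact_mod_cast hp
  -- Dividing by the gcd `p` of the coordinates from `k` on makes these integral with gcd `1`.
  -- Rounding the earlier ones makes `w` admissible in the reduction condition, with an error `r`
  -- supported before `k` and at most `1/2` there.
  let w : Fin g → ℤ := fun i => if k ≤ i then c i else round ((p : ℝ)⁻¹ * a i)
  have hw1 : (Finset.univ.filter (k ≤ ·)).gcd w = 1 := by
    rw [← hc1]
    exact Finset.gcd_congr rfl fun i hi => if_pos (by simpa using hi)
  have h1 := h.1 k w hw1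
  let r : Fin g → ℝ := fun i => (w i : ℝ) - (p : ℝ)⁻¹ * a i
  have hr0 : ∀ i, k ≤ i → r i = 0 := by
    intro i hi
    have : (a i : ℝ) = p * c i := by exact_mod_cast hc i (by simp [hi])
    simp only [r, w, if_pos hi, this]
    field_simp
    ring
  have hr1 : ∀ i, |r i| ≤ 1 / 2 := by
    intro i
    by_cases hi : k ≤ i
    · rw [hr0 i hi]; norm_num
    · simp only [r, w, if_neg hi]
      rw [abs_sub_comm]
      exact abs_sub_round _
  have hsum : (fun i => (w i : ℝ)) = (p : ℝ)⁻¹ • (fun i => (a i : ℝ)) + r := by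
    ext i
    simp [r]
  have hp2 : ((p : ℝ)⁻¹) ^ 2 ≤ 1 := by
    rw [inv_pow]
    apply inv_le_one_of_one_le₀
    have : (1 : ℤ) ≤ p ^ 2 := Int.add_one_le_iff.2 (sq_pos_of_ne_zero hp)
    exact_mod_cast this
  rw [hsum] at h1
  have h2 := hY.form_add_le ((p : ℝ)⁻¹ • (fun i => (a i : ℝ))) r
  rw [Matrix.form_smul] at h2
  have h3 : (p : ℝ)⁻¹ ^ 2 * ((fun i => (a i : ℝ)) ⬝ᵥ (Y *ᵥ fun i => (a i : ℝ))) ≤ R := by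
    have := hY.form_nonneg (fun i => (a i : ℝ))
    nlinarith
  have hdiag : ∀ i, 0 ≤ Y i i := fun i => hY.diag_nonneg
  have h4 : r ⬝ᵥ (Y *ᵥ r) ≤ (g : ℝ) / 4 * ∑ i ∈ Finset.univ.filter (· < k), Y i i := by
    have h5 : ∀ i j, r i * (Y i j * r j) ≤
        (if i < k then (1 / 8 : ℝ) * Y i i else 0) + (if j < k then (1 / 8 : ℝ) * Y j j else 0) := by
      intro i j
      by_cases hi : i < k
      · by_cases hj : j < k
        · rw [if_pos hi, if_pos hj]
          have hs : Y j i = Y i j := by simpa using hY.isHermitian.apply i j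
          have h6 := hY.form_nonneg (Pi.single i (r i) - Pi.single j (r j))
          simp only [mulVec_sub, sub_dotProduct, dotProduct_sub, mulVec_single,
            single_dotProduct, Pi.smul_apply, Matrix.col_apply, hs, op_smul_eq_smul,
            smul_eq_mul] at h6
          have h7 : ∀ i, r i ^ 2 * Y i i ≤ 1 / 4 * Y i i := fun i => by
            refine mul_le_mul_of_nonneg_right ?_ (hdiag i)
            rw [← sq_abs]
            nlinarith [hr1 i, abs_nonneg (r i)]
          have := h7 i
          have := h7 j
          nlinarith
        · rw [hr0 j (not_lt.1 hj), if_neg hj, if_pos hi]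
          have := hdiag i
          simp only [mul_zero]
          positivity
      · rw [hr0 i (not_lt.1 hi), zero_mul]
        have := hdiag i
        have := hdiag j
        split_ifs <;> positivity
    calc r ⬝ᵥ (Y *ᵥ r) = ∑ i, ∑ j, r i * (Y i j * r j) := by
          simp [dotProduct, mulVec, Finset.mul_sum]
      _ ≤ ∑ i, ∑ j, ((if i < k then (1 / 8 : ℝ) * Y i i else 0) +
            (if j < k then (1 / 8 : ℝ) * Y j j else 0)) :=
          Finset.sum_le_sum fun i _ => Finset.sum_le_sum fun j _ => h5 i j
      _ = _ := by
          simp only [Finset.sum_add_distrib, Finset.sum_const, Finset.card_univ, Fintype.card_fin,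
            nsmul_eq_mul, ← Finset.sum_filter, ← Finset.mul_sum]
          ring
  -- The estimates give `Y_kk ≤ 2R + (g/2) ∑_{i<k} Y_ii`; with the induction hypothesis the sum is
  -- geometric of ratio `1 + g`.
  have h8 : ∑ i ∈ Finset.univ.filter (· < k), Y i i ≤
      ∑ l ∈ Finset.range m, 2 * R * (1 + (g : ℝ)) ^ l := by
    have hbij : ∑ i ∈ Finset.univ.filter (· < k), (2 * R * (1 + (g : ℝ)) ^ (i : ℕ)) =
        ∑ l ∈ Finset.range m, 2 * R * (1 + (g : ℝ)) ^ l := by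
      refine Finset.sum_bij (fun i _ => (i : ℕ)) ?_ ?_ ?_ ?_
      · intro i hi
        simpa [hk, Fin.lt_def] using hi
      · intro i _ j _ hij
        exact Fin.ext hij
      · intro l hl
        have hl' := Finset.mem_range.1 hl
        exact ⟨⟨l, hl'.trans hm⟩, by simpa [hk, Fin.lt_def] using hl', rfl⟩
      · intro i _
        rfl
    rw [← hbij]
    refine Finset.sum_le_sum fun i hi => ih i ?_ i.2
    simpa [hk, Fin.lt_def] using hi
  have hgeom : (g : ℝ) * ∑ l ∈ Finset.range m, (1 + (g : ℝ)) ^ l = (1 + (g : ℝ)) ^ m - 1 := by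
    have := geom_sum_mul (1 + (g : ℝ)) m
    rw [add_sub_cancel_left] at this
    rw [mul_comm, this]
  rw [← Finset.mul_sum] at h8
  have h9 : (g : ℝ) / 4 * ∑ i ∈ Finset.univ.filter (· < k), Y i i ≤
      (g : ℝ) / 4 * (2 * R * ∑ l ∈ Finset.range m, (1 + (g : ℝ)) ^ l) :=
    mul_le_mul_of_nonneg_left h8 (by positivity)
  have h10 : (g : ℝ) / 4 * (2 * R * ∑ l ∈ Finset.range m, (1 + (g : ℝ)) ^ l) =
      R / 2 * ((1 + (g : ℝ)) ^ m - 1) := by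
    rw [← hgeom]
    ring
  have h11 : (1 : ℝ) ≤ (1 + (g : ℝ)) ^ m := one_le_pow₀ (by linarith [(Nat.cast_nonneg g : (0:ℝ) ≤ g)])
  have h12 : 0 ≤ R * ((1 + (g : ℝ)) ^ m - 1) := mul_nonneg hR (by linarith)
  nlinarith

/-- The partial inversion in the coordinate `k`. -/
def partialInversion {g : ℕ} (k : Fin g) : Sp g :=
  ⟨Matrix.fromBlocks (1 - Matrix.diagonal (Pi.single k 1)) (-Matrix.diagonal (Pi.single k 1))
    (Matrix.diagonal (Pi.single k 1)) (1 - Matrix.diagonal (Pi.single k 1)), by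
    have hE : (Matrix.diagonal (Pi.single k (1 : ℤ)) : Matrix (Fin g) (Fin g) ℤ) *
        Matrix.diagonal (Pi.single k 1) = Matrix.diagonal (Pi.single k 1) := by
      rw [Matrix.diagonal_mul_diagonal]
      congr 1
      ext i
      by_cases h : i = k
      · subst h; simp
      · simp [h]
    rw [SymplecticGroup.fromBlocks_mem_iff]
    simp only [Matrix.transpose_sub, Matrix.transpose_neg, Matrix.transpose_one,
      Matrix.diagonal_transpose, mul_sub, sub_mul, mul_neg, neg_mul, hE, mul_one, one_mul]
    refine ⟨trivial, ?_, ?_⟩ <;> abel⟩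

/-- Here `C Z + D` is the identity with its `k`-th row replaced by that of `Z`. The determinant
condition thus reads `|z_kk| ≥ 1`. -/
theorem det_blockC_partialInversion (k : Fin g) (Z : Matrix (Fin g) (Fin g) ℂ) :
    (blockC (partialInversion k) * Z + blockD (partialInversion k)).det = Z k k := by
  have h1 : blockC (partialInversion k) * Z + blockD (partialInversion k) =
      (1 : Matrix (Fin g) (Fin g) ℂ).updateRow k (Z k) := by
    have hC : blockC (partialInversion k) = Matrix.diagonal (Pi.single k 1) := by
      ext i j
      by_cases hij : i = j <;> by_cases hik : i = k <;>
        simp [blockC, partialInversion, Matrix.toBlocks₂₁, Matrix.diagonal_apply, hij, hik,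
          Pi.single_apply]
    have hD : blockD (partialInversion k) = 1 - Matrix.diagonal (Pi.single k 1) := by
      ext i j
      by_cases hij : i = j <;> by_cases hik : i = k <;>
        simp [blockD, partialInversion, Matrix.toBlocks₂₂, Matrix.diagonal_apply, hij, hik,
          Pi.single_apply, Matrix.one_apply]
    rw [hC, hD]
    ext i j
    rw [Matrix.add_apply, Matrix.diagonal_mul, Matrix.updateRow_apply]
    by_cases hik : i = k <;> by_cases hij : i = j <;>
      simp_all [Matrix.one_apply]
  rw [h1, ← Matrix.cramer_transpose_apply, Matrix.transpose_one, Matrix.cramer_one]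
  rfl

/-- From `|z_kk| ≥ 1` and `|Re z_kk| ≤ 1/2` one gets `Im z_kk ≥ √3/2`; `3/4` is a rational
substitute. -/
theorem three_quarters_le_im {Z : Matrix (Fin g) (Fin g) ℂ} (hZ : Z ∈ fundamentalDomain g)
    (k : Fin g) : 3 / 4 ≤ (Z k k).im := by
  obtain ⟨⟨-, hpos⟩, hre, -, hdet⟩ := hZ
  have h1 := hdet (partialInversion k)
  rw [det_blockC_partialInversion] at h1
  have h2 : 0 < (Z k k).im := hpos.diag_pos
  have h3 := hre k k
  have h4 : 1 ≤ (Z k k).re ^ 2 + (Z k k).im ^ 2 := by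
    have := Complex.sq_norm (Z k k)
    rw [Complex.normSq_apply] at this
    nlinarith
  have h5 : (Z k k).re ^ 2 ≤ 1 / 4 := by
    rw [← sq_abs]
    nlinarith [abs_nonneg (Z k k).re]
  nlinarith

/-- On the fundamental domain the imaginary part is bounded below in terms of its entries. -/
theorem sq_le_form_of_mem_fundamentalDomain {Z : Matrix (Fin g) (Fin g) ℂ}
    (hZ : Z ∈ fundamentalDomain g) {T : ℝ} (hT1 : 1 ≤ T)
    (hT : ∀ i j, |(Z.map Complex.im) i j| ≤ T) (x : Fin g → ℝ) (i : Fin g) :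
    x i ^ 2 ≤ 4 * ((3 * g * ⌈T⌉₊ : ℕ) : ℝ) ^ (2 * g) * (x ⬝ᵥ (Z.map Complex.im *ᵥ x)) := by
  have hg : 0 < g := i.pos
  have h0 : 3 / 4 ≤ Z.map Complex.im ⟨0, hg⟩ ⟨0, hg⟩ := three_quarters_le_im hZ _
  have := hZ.1.2.posSemidef.sq_le_form
    (fun a ha => h0.trans (hZ.2.2.1.apply_zero_le hg (by linarith) a ha)) hT1 hT x i
  simpa using this

end Siegel

/-! ### Frames `(Z, 1)` and their change under the symplectic group. -/

namespace Siegel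

variable {g : ℕ}

/-- The vectors with coordinates the columns of `(Z, 1)` with respect to `e`. -/
noncomputable def frame {V : Type*} [AddCommGroup V] [Module ℂ V] (Z : Matrix (Fin g) (Fin g) ℂ)
    (e : Fin g → V) (i : Fin g ⊕ Fin g) : V := ∑ k, Matrix.fromCols Z 1 k i • e k

section

variable {V : Type*} [AddCommGroup V] [Module ℂ V]

theorem frame_inl (Z : Matrix (Fin g) (Fin g) ℂ) (e : Fin g → V) (j : Fin g) :
    frame Z e (Sum.inl j) = ∑ k, Z k j • e k := rfl

theorem frame_inr (Z : Matrix (Fin g) (Fin g) ℂ) (e : Fin g → V) (j : Fin g) :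
    frame Z e (Sum.inr j) = e j := by
  simp [frame, Matrix.one_apply]

theorem sum_smul_sum_smul {κ ι n : Type*} [Fintype κ] [Fintype ι] (P : Matrix ι κ ℂ)
    (M : Matrix κ n ℂ) (e : ι → V) (i : n) :
    ∑ k, M k i • ∑ l, P l k • e l = ∑ l, (P * M) l i • e l := by
  simp only [Finset.smul_sum, smul_smul, Matrix.mul_apply, Finset.sum_smul]
  rw [Finset.sum_comm]
  simp only [mul_comm]

end

theorem fromBlocks_block (s : Sp g) :
    Matrix.fromBlocks (blockA s) (blockB s) (blockC s) (blockD s) =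
      (s : Matrix (Fin g ⊕ Fin g) (Fin g ⊕ Fin g) ℤ).map (Int.cast : ℤ → ℂ) := by
  ext (i | i) (j | j) <;> rfl

theorem map_intCast_mem_symplecticGroup (R : Type*) [CommRing R] (s : Sp g) :
    (s : Matrix (Fin g ⊕ Fin g) (Fin g ⊕ Fin g) ℤ).map (Int.cast : ℤ → R) ∈
      Matrix.symplecticGroup (Fin g) R := by
  have h := SymplecticGroup.map_mem (hA := s.2) (f := Int.castRingHom R)
  rwa [Int.coe_castRingHom] at h

/-- The automorphy factor appears as a change of basis of `V`, and the symplectic matrix as a change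
of lattice basis. The second block is immediate; the first is the symmetry of `(CZ + D)ᵀ (AZ + B)`,
which follows from the symplectic relations and `Zᵀ = Z`. -/
theorem fromCols_mul_transpose (s : Sp g) {Z : Matrix (Fin g) (Fin g) ℂ} (hZ : Zᵀ = Z)
    (hdet : (blockC s * Z + blockD s).det ≠ 0) :
    (Matrix.fromCols Z 1 : Matrix (Fin g) (Fin g ⊕ Fin g) ℂ) *
        ((s : Matrix (Fin g ⊕ Fin g) (Fin g ⊕ Fin g) ℤ).map (Int.cast : ℤ → ℂ))ᵀ =
      (blockC s * Z + blockD s)ᵀ *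
        (Matrix.fromCols (act s Z) 1 : Matrix (Fin g) (Fin g ⊕ Fin g) ℂ) := by
  have hs : Matrix.fromBlocks (blockA s) (blockB s) (blockC s) (blockD s) ∈
      Matrix.symplecticGroup (Fin g) ℂ := by
    rw [fromBlocks_block]
    exact map_intCast_mem_symplecticGroup ℂ s
  obtain ⟨h1, h2, h3⟩ := SymplecticGroup.fromBlocks_mem_iff.1 hs
  have h4 : (blockD s)ᵀ * blockA s - (blockB s)ᵀ * blockC s = 1 := by
    simpa using congrArg Matrix.transpose h3
  rw [← fromBlocks_block, Matrix.fromBlocks_transpose, Matrix.fromCols_mul_fromBlocks,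
    Matrix.mul_fromCols, Matrix.mul_one, one_mul, one_mul]
  have key : (blockC s * Z + blockD s)ᵀ * (blockA s * Z + blockB s) =
      (Z * (blockA s)ᵀ + (blockB s)ᵀ) * (blockC s * Z + blockD s) := by
    rw [Matrix.transpose_add, Matrix.transpose_mul, hZ]
    have h5 : Z * ((blockA s)ᵀ * blockD s) - Z * ((blockC s)ᵀ * blockB s) = Z := by
      rw [← mul_sub, h3, mul_one]
    have h6 : (blockD s)ᵀ * blockA s * Z - (blockB s)ᵀ * blockC s * Z = Z := by
      rw [← sub_mul, h4, one_mul]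
    have h7 : Z * ((blockC s)ᵀ * blockA s) * Z = Z * ((blockA s)ᵀ * blockC s) * Z := by rw [h1]
    simp only [add_mul, mul_add, ← mul_assoc] at h5 h6 h7 ⊢
    rw [h7, h2, sub_eq_iff_eq_add.1 h5, sub_eq_iff_eq_add.1 h6]
    abel
  congr 1
  · rw [act, ← mul_assoc, key, Matrix.mul_nonsing_inv_cancel_right _ _ (isUnit_iff_ne_zero.2 hdet)]
  · rw [Matrix.transpose_add, Matrix.transpose_mul, hZ]

end Siegel

namespace ComplexTorus.Polarization

variable {V : Type*} [NormedAddCommGroup V] [NormedSpace ℂ V] {Λ : Submodule ℤ V}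
  (L : Polarization Λ) {g : ℕ} {Z : Matrix (Fin g) (Fin g) ℂ} {e : Fin g → V}

/-- The columns of `(Z, 1)` form a symplectic family of principal type. -/
def IsFrame (Z : Matrix (Fin g) (Fin g) ℂ) (e : Fin g → V) : Prop :=
  Matrix.of (fun i j => L.imForm (frame Z e i) (frame Z e j)) = -Matrix.J (Fin g) ℝ

/-- The new basis is `e` changed by the inverse of `(CZ + D)ᵀ`. Since `s` preserves `J`, it can be
cancelled from both sides of the Gram identity. -/
theorem IsFrame.exists_of_act (s : Sp g) (hZ : Zᵀ = Z)
    (hdet : (blockC s * Z + blockD s).det ≠ 0) (h : L.IsFrame (act s Z) e) :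
    ∃ e' : Fin g → V, L.IsFrame Z e' ∧ ∀ i, frame (act s Z) e i =
      ∑ j, ((s : Matrix (Fin g ⊕ Fin g) (Fin g ⊕ Fin g) ℤ) i j : ℝ) • frame Z e' j := by
  set P := (blockC s * Z + blockD s)ᵀ with hP
  have hPdet : IsUnit P.det := by
    rw [hP, Matrix.det_transpose]
    exact isUnit_iff_ne_zero.2 hdet
  let e' : Fin g → V := fun k => ∑ l, P⁻¹ l k • e l
  have he' : ∀ i, frame Z e' i = ∑ l, (P⁻¹ * Matrix.fromCols Z 1) l i • e l :=
    fun i => sum_smul_sum_smul _ _ _ _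
  have hframe : ∀ i, frame (act s Z) e i =
      ∑ j, ((s : Matrix (Fin g ⊕ Fin g) (Fin g ⊕ Fin g) ℤ) i j : ℝ) • frame Z e' j := by
    intro i
    have h1 : ∀ j, ((s : Matrix (Fin g ⊕ Fin g) (Fin g ⊕ Fin g) ℤ) i j : ℝ) • frame Z e' j =
        ((s : Matrix (Fin g ⊕ Fin g) (Fin g ⊕ Fin g) ℤ).map (Int.cast : ℤ → ℂ))ᵀ j i •
          ∑ l, (P⁻¹ * Matrix.fromCols Z 1) l j • e l := by
      intro j
      rw [he', ← Complex.coe_smul]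
      simp
    rw [Finset.sum_congr rfl fun j _ => h1 j, sum_smul_sum_smul, Matrix.mul_assoc,
      fromCols_mul_transpose s hZ hdet, ← Matrix.mul_assoc, Matrix.nonsing_inv_mul _ hPdet,
      Matrix.one_mul]
    rfl
  refine ⟨e', ?_, hframe⟩
  set S : Matrix (Fin g ⊕ Fin g) (Fin g ⊕ Fin g) ℝ :=
    (s : Matrix (Fin g ⊕ Fin g) (Fin g ⊕ Fin g) ℤ).map (Int.cast : ℤ → ℝ) with hS
  have hSmem : S ∈ Matrix.symplecticGroup (Fin g) ℝ :=
    map_intCast_mem_symplecticGroup ℝ s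
  have hSdet : IsUnit S.det := SymplecticGroup.symplectic_det hSmem
  set G : Matrix (Fin g ⊕ Fin g) (Fin g ⊕ Fin g) ℝ :=
    Matrix.of (fun i j => L.imForm (frame Z e' i) (frame Z e' j)) with hG
  have h1 : S * G * Sᵀ = S * (-Matrix.J (Fin g) ℝ) * Sᵀ := by
    rw [mul_neg, neg_mul, SymplecticGroup.mem_iff.1 hSmem]
    refine Eq.trans ?_ h
    ext i j
    rw [Matrix.of_apply, hframe, hframe]
    simp only [Matrix.mul_apply, Matrix.transpose_apply, map_sum, map_smul, LinearMap.sum_apply,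
      LinearMap.smul_apply, smul_eq_mul, Finset.sum_mul, Finset.mul_sum, hG, hS, Matrix.of_apply,
      Matrix.map_apply]
    refine Finset.sum_congr rfl fun k _ => Finset.sum_congr rfl fun l _ => by ring
  have hSt : IsUnit Sᵀ.det := by rwa [Matrix.det_transpose]
  have h2 := congrArg (fun M => S⁻¹ * (M * Sᵀ⁻¹)) h1
  simp only [Matrix.mul_nonsing_inv_cancel_right _ _ hSt,
    Matrix.nonsing_inv_mul_cancel_left _ _ hSdet] at h2
  exact h2

variable {L}

theorem IsFrame.imForm_eq_zero (h : L.IsFrame Z e) (j k : Fin g) : L.imForm (e j) (e k) = 0 := by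
  have := congrFun (congrFun h (Sum.inr j)) (Sum.inr k)
  rw [Matrix.of_apply, frame_inr, frame_inr] at this
  simpa [Matrix.J] using this

theorem IsFrame.imForm_frame_inl (h : L.IsFrame Z e) (j k : Fin g) :
    L.imForm (frame Z e (Sum.inl j)) (e k) = if j = k then 1 else 0 := by
  have := congrFun (congrFun h (Sum.inl j)) (Sum.inr k)
  rw [Matrix.of_apply, frame_inr] at this
  simpa [Matrix.J, Matrix.one_apply] using this

theorem sum_complex_smul (c : Fin g → ℂ) (e : Fin g → V) :
    ∑ k, c k • e k = ∑ k, (c k).re • e k + Complex.I • ∑ k, (c k).im • e k := by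
  rw [Finset.smul_sum, ← Finset.sum_add_distrib]
  refine Finset.sum_congr rfl fun k _ => ?_
  rw [← Complex.coe_smul, ← Complex.coe_smul, smul_smul, ← add_smul, mul_comm, Complex.re_add_im]

theorem IsFrame.imForm_real_sum (h : L.IsFrame Z e) (x y : Fin g → ℝ) :
    L.imForm (∑ k, x k • e k) (∑ k, y k • e k) = 0 := by
  simp [h.imForm_eq_zero]

/-- The real span of `e` is isotropic for `E`, hence orthogonal to its multiple by `i` for `Re H`.
-/
theorem IsFrame.reForm_sum (h : L.IsFrame Z e) (c : Fin g → ℂ) :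
    L.reForm (∑ k, c k • e k) (∑ k, c k • e k) =
      L.reForm (∑ k, (c k).re • e k) (∑ k, (c k).re • e k) +
      L.reForm (∑ k, (c k).im • e k) (∑ k, (c k).im • e k) := by
  rw [sum_complex_smul]
  set u := ∑ k, (c k).re • e k
  set w := ∑ k, (c k).im • e k
  have h1 : L.reForm u (Complex.I • w) = 0 := by
    rw [← imForm_eq_reForm_I_smul]
    exact h.imForm_real_sum _ _
  have h2 : L.reForm (Complex.I • w) u = 0 := by rw [reForm_comm, h1]
  simp only [map_add, LinearMap.add_apply, h1, h2, reForm_I_smul_I_smul]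
  ring

/-- In other words, the Gram matrix of `H` on `e` is `(Im Z)⁻¹`. Pairing `e_k` with a column of `Z`
under `E` kills the real part by isotropy and turns the imaginary part into `Re H`. -/
theorem IsFrame.reForm_sum_im (h : L.IsFrame Z e) (j k : Fin g) :
    L.reForm (e k) (∑ l, (Z l j).im • e l) = if j = k then 1 else 0 := by
  rw [← h.imForm_frame_inl j k, frame_inl, sum_complex_smul, map_add, LinearMap.add_apply]
  have h1 : L.imForm (∑ l, (Z l j).re • e l) (e k) = 0 := by
    simp [h.imForm_eq_zero]
  rw [h1, zero_add, imForm_swap, imForm_eq_reForm_I_smul, smul_smul, Complex.I_mul_I, neg_one_smul,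
    map_neg, neg_neg]

theorem IsFrame.reForm_mulVec (h : L.IsFrame Z e) (a : Fin g → ℝ) (k : Fin g) :
    L.reForm (e k) (∑ l, (Z.map Complex.im *ᵥ a) l • e l) = a k := by
  have h1 : ∑ l, (Z.map Complex.im *ᵥ a) l • e l = ∑ j, a j • ∑ l, (Z l j).im • e l := by
    simp only [Matrix.mulVec, dotProduct, Matrix.map_apply, Finset.sum_smul, Finset.smul_sum,
      smul_smul]
    rw [Finset.sum_comm]
    simp only [mul_comm]
  rw [h1]
  simp [map_sum, h.reForm_sum_im, -map_smul]

theorem IsFrame.reForm_mulVec_self (h : L.IsFrame Z e) (a : Fin g → ℝ) :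
    L.reForm (∑ l, (Z.map Complex.im *ᵥ a) l • e l) (∑ l, (Z.map Complex.im *ᵥ a) l • e l) =
      a ⬝ᵥ (Z.map Complex.im *ᵥ a) := by
  have h1 : ∀ v, L.reForm (∑ l, (Z.map Complex.im *ᵥ a) l • e l) v =
      ∑ l, (Z.map Complex.im *ᵥ a) l * L.reForm (e l) v := fun v => by
    simp
  rw [h1, dotProduct_comm]
  simp only [h.reForm_mulVec]
  rfl

/-- The form `Y[a]` is at most the value of `H` on any lattice vector with first coordinates `a`. -/
theorem IsFrame.form_le (h : L.IsFrame Z e) (x : Fin g ⊕ Fin g → ℝ) :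
    (fun l => x (Sum.inl l)) ⬝ᵥ (Z.map Complex.im *ᵥ fun l => x (Sum.inl l)) ≤
      L.reForm (∑ i, x i • frame Z e i) (∑ i, x i • frame Z e i) := by
  let c : Fin g → ℂ := fun l => ∑ j, (x (Sum.inl j) : ℂ) * Z l j + x (Sum.inr l)
  have h1 : ∑ i, x i • frame Z e i = ∑ l, c l • e l := by
    simp only [Fintype.sum_sum_type, frame_inr, frame_inl, c, add_smul, Finset.sum_add_distrib,
      Finset.sum_smul, Complex.coe_smul, Finset.smul_sum]
    congr 1
    rw [Finset.sum_comm]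
    refine Finset.sum_congr rfl fun k _ => Finset.sum_congr rfl fun l _ => ?_
    rw [mul_smul, Complex.coe_smul]
  have h2 : ∀ l, (c l).im = (Z.map Complex.im *ᵥ fun l => x (Sum.inl l)) l := by
    intro l
    simp [c, Matrix.mulVec, dotProduct, mul_comm]
  rw [h1, h.reForm_sum]
  simp only [h2]
  rw [h.reForm_mulVec_self]
  linarith [L.reForm_self_nonneg (∑ k, (c k).re • e k)]

/-- The `k`-th Gram row `x` of `e` solves `Y x = e_k` for `Y = Im Z`, so `Y[x] = x_k`, and the lower
bound for `Y` becomes `x_k² ≤ B x_k`. -/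
theorem IsFrame.reForm_self_le (h : L.IsFrame Z e) (hZ : Zᵀ = Z) {B : ℝ} (hB : 0 ≤ B)
    (hY : ∀ (x : Fin g → ℝ) i, x i ^ 2 ≤ B * (x ⬝ᵥ (Z.map Complex.im *ᵥ x))) (k : Fin g) :
    L.reForm (e k) (e k) ≤ B := by
  let x : Fin g → ℝ := fun l => L.reForm (e k) (e l)
  have hx : Z.map Complex.im *ᵥ x = Pi.single k 1 := by
    ext j
    have h1 := h.reForm_sum_im j k
    simp only [map_sum, map_smul, smul_eq_mul] at h1
    have h3 : (Z.map Complex.im *ᵥ x) j = ∑ l, (Z j l).im * x l := rfl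
    rw [Pi.single_apply, h3]
    refine Eq.trans ?_ (h1.trans (by simp only [eq_comm]))
    refine Finset.sum_congr rfl fun l _ => ?_
    have h2 : Z j l = Z l j := congrFun (congrFun hZ l) j
    rw [h2]
  have h3 := hY x k
  rw [hx, dotProduct_single, mul_one] at h3
  have h4 : x k * x k ≤ B * x k := by rw [← sq]; exact h3
  rcases (L.reForm_self_nonneg (e k)).eq_or_lt with h5 | h5
  · rw [← h5]; exact hB
  · exact le_of_mul_le_mul_right h4 h5

/-- A column of `Z = X + iY` splits orthogonally: the `Y` part contributes `Y_jj`, and the `X` part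
at most `g² B` because the entries of `X` are bounded. -/
theorem IsFrame.reForm_frame_le (h : L.IsFrame Z e) (hZ : Zᵀ = Z)
    (hX : ∀ i j, |(Z i j).re| ≤ 1 / 2) {B T : ℝ} (hB : 0 ≤ B) (hT0 : 0 ≤ T)
    (hT : ∀ i, (Z i i).im ≤ T)
    (hY : ∀ (x : Fin g → ℝ) i, x i ^ 2 ≤ B * (x ⬝ᵥ (Z.map Complex.im *ᵥ x)))
    (i : Fin g ⊕ Fin g) :
    L.reForm (frame Z e i) (frame Z e i) ≤ T + (g : ℝ) ^ 2 * B := by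
  have hk := h.reForm_self_le hZ hB hY
  rcases i with j | k
  · rw [frame_inl, h.reForm_sum]
    have h1 : ∑ l, (Z l j).im • e l =
        ∑ l, (Z.map Complex.im *ᵥ (Pi.single j 1 : Fin g → ℝ)) l • e l := by
      simp
    rw [h1, h.reForm_mulVec_self]
    have h2 : (Pi.single j 1 : Fin g → ℝ) ⬝ᵥ (Z.map Complex.im *ᵥ (Pi.single j 1 : Fin g → ℝ)) =
        (Z j j).im := by simp
    rw [h2]
    have h3 := L.reForm_sum_self_le Finset.univ fun l => (Z l j).re • e l
    have h4 : ∀ l ∈ Finset.univ, L.reForm ((Z l j).re • e l) ((Z l j).re • e l) ≤ B := by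
      intro l _
      simp only [LinearMap.map_smul, LinearMap.smul_apply, smul_eq_mul]
      have h5 := hk l
      have h6 := L.reForm_self_nonneg (e l)
      have h7 : (Z l j).re * (Z l j).re ≤ 1 := by
        have := hX l j
        rw [abs_le] at this
        nlinarith
      nlinarith
    have h8 := Finset.sum_le_sum h4
    rw [Finset.sum_const, Finset.card_univ, Fintype.card_fin, nsmul_eq_mul] at h8
    rw [Finset.card_univ, Fintype.card_fin] at h3
    have h9 := mul_le_mul_of_nonneg_left h8 (Nat.cast_nonneg (α := ℝ) g)
    have := hT j
    nlinarith
  · rw [frame_inr]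
    have h1 : (1 : ℝ) ≤ (g : ℝ) ^ 2 := by
      have : (1 : ℝ) ≤ g := by exact_mod_cast k.pos
      nlinarith
    nlinarith [hk k]

end ComplexTorus.Polarization

/-! ### The explicit constant and its computability. -/

namespace Siegel

/-- The constant bounding the polarization on frames over the fundamental domain. -/
def frameBound (g : ℕ) : ℕ := 1 + 4 * g ^ 2 * (6 * g) ^ (2 * g)

/-- The constant of the upper bound. -/
def repBound (g N : ℕ) : ℕ :=
  4 * g ^ 2 * N ^ 2 * (frameBound g * (2 * frameBound g * (1 + g) ^ g) ^ (2 * g)) + 1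

theorem primrec_frameBound : Primrec frameBound := by
  have hpow : Primrec₂ ((· ^ ·) : ℕ → ℕ → ℕ) := Primrec₂.unpaired'.1 Nat.Primrec.pow
  have hc : ∀ c : ℕ, Primrec fun _ : ℕ => c := fun c => Primrec.const c
  have h2g : Primrec fun g : ℕ => 2 * g := Primrec.nat_mul.comp (hc 2) Primrec.id
  exact Primrec.nat_add.comp (hc 1) (Primrec.nat_mul.comp
    (Primrec.nat_mul.comp (hc 4) (hpow.comp Primrec.id (hc 2)))
    (hpow.comp (Primrec.nat_mul.comp (hc 6) Primrec.id) h2g))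

theorem computable_repBound : Computable₂ repBound := by
  have hpow : Primrec₂ ((· ^ ·) : ℕ → ℕ → ℕ) := Primrec₂.unpaired'.1 Nat.Primrec.pow
  have hc : ∀ c : ℕ, Primrec fun _ : ℕ × ℕ => c := fun c => Primrec.const c
  have h2g : Primrec fun p : ℕ × ℕ => 2 * p.1 := Primrec.nat_mul.comp (hc 2) Primrec.fst
  have hb : Primrec fun p : ℕ × ℕ => frameBound p.1 := primrec_frameBound.comp Primrec.fst
  have h : Primrec₂ repBound := Primrec.nat_add.comp (Primrec.nat_mul.comp
    (Primrec.nat_mul.comp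
      (Primrec.nat_mul.comp (hc 4) (hpow.comp Primrec.fst (hc 2)))
      (hpow.comp Primrec.snd (hc 2)))
    (Primrec.nat_mul.comp hb (hpow.comp (Primrec.nat_mul.comp
      (Primrec.nat_mul.comp (hc 2) hb)
      (hpow.comp (Primrec.nat_add.comp (hc 1) Primrec.fst) Primrec.fst)) h2g))) (hc 1)
  exact h.to_comp

theorem one_le_frameBound (g : ℕ) : 1 ≤ frameBound g := Nat.le_add_right _ _

theorem natAbs_le_maxEntry {g n : ℕ} (σ : Fin n → Sp g) (k : Fin n) (i j : Fin g ⊕ Fin g) :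
    ((σ k : Matrix (Fin g ⊕ Fin g) (Fin g ⊕ Fin g) ℤ) i j).natAbs ≤ maxEntry σ :=
  Finset.le_sup (f := fun p : Fin n × (Fin g ⊕ Fin g) × (Fin g ⊕ Fin g) =>
    ((σ p.1 : Matrix (Fin g ⊕ Fin g) (Fin g ⊕ Fin g) ℤ) p.2.1 p.2.2).natAbs)
    (Finset.mem_univ (k, i, j))

end Siegel

/-! ### Bounds for the polarization on lattice vectors. -/

namespace ComplexTorus.Polarization

variable {V : Type*} [NormedAddCommGroup V] [NormedSpace ℂ V] {Λ : Submodule ℤ V}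
  {L : Polarization Λ} {g : ℕ} {Z Z' : Matrix (Fin g) (Fin g) ℂ} {e e' : Fin g → V}

theorem IsFrame.reForm_frame_le_of_mem (h : L.IsFrame Z e) (hZ : Z ∈ fundamentalDomain g) {T : ℝ}
    (hT1 : 1 ≤ T) (hT : ∀ i j, |(Z.map Complex.im) i j| ≤ T) (i : Fin g ⊕ Fin g) :
    L.reForm (frame Z e i) (frame Z e i) ≤ frameBound g * T ^ (2 * g) := by
  have hg : 0 < g := by rcases i with i | i <;> exact i.pos
  have h1 := h.reForm_frame_le hZ.1.1 hZ.2.1 (by positivity) (by linarith)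
    (fun i => (le_abs_self _).trans (hT i i)) (sq_le_form_of_mem_fundamentalDomain hZ hT1 hT) i
  refine h1.trans ?_
  -- Replacing `⌈T⌉` by `2T` turns `3g⌈T⌉` into the `6g` of `frameBound`.
  have hceil : (⌈T⌉₊ : ℝ) ≤ 2 * T := by
    have := Nat.ceil_lt_add_one (a := T) (by linarith)
    linarith
  have h2 : ((3 * g * ⌈T⌉₊ : ℕ) : ℝ) ^ (2 * g) ≤ (6 * g) ^ (2 * g) * T ^ (2 * g) := by
    rw [← mul_pow]
    refine pow_le_pow_left₀ (by positivity) ?_ _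
    push_cast
    have : (0 : ℝ) ≤ g := Nat.cast_nonneg g
    nlinarith
  have h3 : T ≤ T ^ (2 * g) := le_self_pow₀ hT1 (by omega)
  have h4 := mul_le_mul_of_nonneg_left h2 (by positivity : (0 : ℝ) ≤ 4 * (g : ℝ) ^ 2)
  have h5 : (frameBound g : ℝ) * T ^ (2 * g) =
      T ^ (2 * g) + 4 * (g : ℝ) ^ 2 * ((6 * g) ^ (2 * g) * T ^ (2 * g)) := by
    rw [frameBound]
    push_cast
    ring
  linarith

/-- The imaginary parts of two points of the fundamental domain which are the frames of one
lattice bound each other polynomially. -/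
theorem IsFrame.abs_im_le (h : L.IsFrame Z e) (h' : L.IsFrame Z' e')
    (hZ : Z ∈ fundamentalDomain g) (hZ' : Z' ∈ fundamentalDomain g) {T : ℝ} (hT1 : 1 ≤ T)
    (hT : ∀ i j, |(Z.map Complex.im) i j| ≤ T) (u : Sp g)
    (hu : ∀ i, frame Z e i =
      ∑ j, ((u : Matrix (Fin g ⊕ Fin g) (Fin g ⊕ Fin g) ℤ) i j : ℝ) • frame Z' e' j)
    (i j : Fin g) :
    |(Z'.map Complex.im) i j| ≤ 2 * frameBound g * (1 + g) ^ g * T ^ (2 * g) := by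
  have hpsd := hZ'.1.2.posSemidef
  set R : ℝ := frameBound g * T ^ (2 * g) with hR
  have hR0 : 0 ≤ R := by positivity
  -- The rows of `u` are the coordinates of the short vectors of the first frame, so their left
  -- halves have small value under `Im Z'` by `form_le`. As `u` is invertible, its `k`-th column is
  -- nonzero, and some row serves for `k`.
  have hex : ∀ k : Fin g, ∃ a : Fin g → ℤ, (fun i => (a i : ℝ)) ⬝ᵥ
      (Z'.map Complex.im *ᵥ fun i => (a i : ℝ)) ≤ R ∧ ∃ i, k ≤ i ∧ a i ≠ 0 := by
    intro k
    have hunit : (((u⁻¹ : Sp g) : Matrix (Fin g ⊕ Fin g) (Fin g ⊕ Fin g) ℤ) *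
        (u : Matrix (Fin g ⊕ Fin g) (Fin g ⊕ Fin g) ℤ)) (Sum.inl k) (Sum.inl k) = 1 := by
      have h1 := congrArg (fun w : Sp g => (w : Matrix (Fin g ⊕ Fin g) (Fin g ⊕ Fin g) ℤ)
        (Sum.inl k) (Sum.inl k)) (inv_mul_cancel u)
      exact h1.trans (by simp)
    obtain ⟨m, hm⟩ : ∃ m, (u : Matrix (Fin g ⊕ Fin g) (Fin g ⊕ Fin g) ℤ) m (Sum.inl k) ≠ 0 := by
      by_contra! hcon
      rw [Matrix.mul_apply] at hunit
      simp [hcon] at hunit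
    refine ⟨fun l => (u : Matrix (Fin g ⊕ Fin g) (Fin g ⊕ Fin g) ℤ) m (Sum.inl l), ?_, k, le_rfl, hm⟩
    have h1 := h.reForm_frame_le_of_mem hZ hT1 hT m
    rw [hu m] at h1
    exact (h'.form_le _).trans h1
  have hg1 : (1 : ℝ) ≤ 1 + g := by
    have : (0 : ℝ) ≤ g := Nat.cast_nonneg g
    linarith
  have hdiag : ∀ k, (Z'.map Complex.im) k k ≤ 2 * frameBound g * (1 + g) ^ g * T ^ (2 * g) := by
    intro k
    refine (hZ'.2.2.1.apply_self_le hpsd hR0 hex k k.2).trans ?_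
    have h1 : (1 + (g : ℝ)) ^ (k : ℕ) ≤ (1 + (g : ℝ)) ^ g := pow_le_pow_right₀ hg1 k.2.le
    have h2 := mul_le_mul_of_nonneg_left h1 (by positivity : 0 ≤ 2 * R)
    refine h2.trans (le_of_eq ?_)
    rw [hR]
    ring
  exact hpsd.abs_apply_le hdiag i j

/-- The polarization is bounded on a frame over the orbit of a point of the fundamental domain. -/
theorem IsFrame.reForm_frame_act_le {s s' : Sp g} {τ : Matrix (Fin g) (Fin g) ℂ}
    (h : L.IsFrame τ e) (hs : τ = act s Z) (hs' : τ = act s' Z')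
    (hZ : Z ∈ fundamentalDomain g) (hZ' : Z' ∈ fundamentalDomain g) {T : ℝ} (hT1 : 1 ≤ T)
    (hT : ∀ i j, |(Z.map Complex.im) i j| ≤ T) {N : ℕ}
    (hN : ∀ i j, ((s' : Matrix (Fin g ⊕ Fin g) (Fin g ⊕ Fin g) ℤ) i j).natAbs ≤ N)
    (i : Fin g ⊕ Fin g) :
    L.reForm (frame τ e i) (frame τ e i) ≤ repBound g N * T ^ (4 * g ^ 2) := by
  have hdet : ∀ {W : Matrix (Fin g) (Fin g) ℂ}, W ∈ fundamentalDomain g → ∀ w : Sp g,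
      (blockC w * W + blockD w).det ≠ 0 := fun hW w h0 => by
    have := hW.2.2.2 w
    rw [h0, norm_zero] at this
    linarith
  obtain ⟨e₁, h₁, hf₁⟩ := IsFrame.exists_of_act L s hZ.1.1 (hdet hZ s) (hs ▸ h)
  obtain ⟨e₂, h₂, hf₂⟩ := IsFrame.exists_of_act L s' hZ'.1.1 (hdet hZ' s') (hs' ▸ h)
  rw [← hs] at hf₁
  rw [← hs'] at hf₂
  -- The frames over `Z` and `Z'` differ by `s⁻¹ s'`. Nothing is known about the size of `s`; only
  -- the entries of `s'` enter the final bound.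
  have hu : ∀ i, frame Z e₁ i = ∑ j, (((s⁻¹ * s' : Sp g) :
      Matrix (Fin g ⊕ Fin g) (Fin g ⊕ Fin g) ℤ) i j : ℝ) • frame Z' e₂ j := by
    intro i
    have h1 : ∑ k, (((s⁻¹ : Sp g) : Matrix (Fin g ⊕ Fin g) (Fin g ⊕ Fin g) ℤ) i k : ℝ) •
        frame τ e k = frame Z e₁ i := by
      simp only [hf₁, Finset.smul_sum, smul_smul]
      rw [Finset.sum_comm]
      simp only [← Finset.sum_smul]
      have h2 : ∀ j, ∑ k, (((s⁻¹ : Sp g) : Matrix (Fin g ⊕ Fin g) (Fin g ⊕ Fin g) ℤ) i k : ℝ) *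
          ((s : Matrix (Fin g ⊕ Fin g) (Fin g ⊕ Fin g) ℤ) k j : ℝ) = if i = j then 1 else 0 := by
        intro j
        have h3 := congrArg (fun w : Sp g => (w : Matrix (Fin g ⊕ Fin g) (Fin g ⊕ Fin g) ℤ)
          i j) (inv_mul_cancel s)
        have h4 : ∑ k, ((s⁻¹ : Sp g) : Matrix (Fin g ⊕ Fin g) (Fin g ⊕ Fin g) ℤ) i k *
            (s : Matrix (Fin g ⊕ Fin g) (Fin g ⊕ Fin g) ℤ) k j = if i = j then 1 else 0 :=
          h3.trans (by simp [Matrix.one_apply])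
        exact_mod_cast h4
      simp only [h2, ite_smul, one_smul, zero_smul, Finset.sum_ite_eq, Finset.mem_univ, if_true]
    rw [← h1]
    simp only [hf₂, Finset.smul_sum, smul_smul]
    rw [Finset.sum_comm]
    simp only [← Finset.sum_smul]
    refine Finset.sum_congr rfl fun j _ => ?_
    congr 1
    rw [Submonoid.coe_mul, Matrix.mul_apply]
    push_cast
    rfl
  set T' : ℝ := 2 * frameBound g * (1 + g) ^ g * T ^ (2 * g) with hT'
  have hb1 : (1 : ℝ) ≤ frameBound g := by exact_mod_cast one_le_frameBound g
  have hT'1 : 1 ≤ T' := by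
    have h1 : (1 : ℝ) ≤ (1 + g) ^ g := one_le_pow₀ (by linarith [(Nat.cast_nonneg g : (0 : ℝ) ≤ g)])
    have h2 : (1 : ℝ) ≤ T ^ (2 * g) := one_le_pow₀ hT1
    have h3 : (1 : ℝ) ≤ 2 * frameBound g := by linarith
    exact one_le_mul_of_one_le_of_one_le (one_le_mul_of_one_le_of_one_le h3 h1) h2
  have hbound := h₂.reForm_frame_le_of_mem hZ' hT'1 (h₁.abs_im_le h₂ hZ hZ' hT1 hT _ hu)
  set R' : ℝ := frameBound g * T' ^ (2 * g) with hR'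
  have hR'0 : 0 ≤ R' := by positivity
  -- The sum has `2g` terms, each at most `N² R'`, whence the factor `4 g² N²` in `repBound`.
  have h1 := L.reForm_sum_self_le Finset.univ fun j =>
    ((s' : Matrix (Fin g ⊕ Fin g) (Fin g ⊕ Fin g) ℤ) i j : ℝ) • frame Z' e₂ j
  rw [← hf₂ i] at h1
  have h2 : ∀ j ∈ Finset.univ,
      L.reForm (((s' : Matrix (Fin g ⊕ Fin g) (Fin g ⊕ Fin g) ℤ) i j : ℝ) • frame Z' e₂ j)
        (((s' : Matrix (Fin g ⊕ Fin g) (Fin g ⊕ Fin g) ℤ) i j : ℝ) • frame Z' e₂ j) ≤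
      (N : ℝ) ^ 2 * R' := by
    intro j _
    simp only [LinearMap.map_smul, LinearMap.smul_apply, smul_eq_mul, ← mul_assoc, ← sq]
    refine mul_le_mul ?_ (hbound j) (L.reForm_self_nonneg _) (by positivity)
    rw [← sq_abs]
    refine pow_le_pow_left₀ (abs_nonneg _) ?_ 2
    rw [← Int.cast_abs, ← Int.natCast_natAbs, Int.cast_natCast]
    exact_mod_cast hN i j
  have h3 := Finset.sum_le_sum h2
  simp only [Finset.sum_const, Finset.card_univ, Fintype.card_sum, Fintype.card_fin,
    nsmul_eq_mul] at h1 h3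
  have h4 := h1.trans (mul_le_mul_of_nonneg_left h3 (Nat.cast_nonneg _))
  refine h4.trans ?_
  have h5 : T' ^ (2 * g) = (2 * frameBound g * (1 + g) ^ g) ^ (2 * g) * T ^ (4 * g ^ 2) := by
    rw [hT', mul_pow, ← pow_mul]
    congr 2
    ring
  have h6 : (0 : ℝ) ≤ T ^ (4 * g ^ 2) := by positivity
  rw [hR', h5, repBound]
  push_cast
  nlinarith

variable {d : Fin g → ℕ} {b : Module.Basis (Fin g ⊕ Fin g) ℤ Λ}

theorem basis_eq_smul_frame {e : Module.Basis (Fin g) ℂ V} {τ : Matrix (Fin g) (Fin g) ℂ}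
    (hp : periodMatrix e b = Matrix.fromCols τ (Matrix.diagonal fun i => (d i : ℂ)))
    (i : Fin g ⊕ Fin g) :
    (b i : V) = (Sum.elim (fun _ => 1) (fun k => (d k : ℝ)) i : ℝ) • frame τ e i := by
  have h1 : ∀ k, e.repr (b i : V) k =
      Matrix.fromCols τ (Matrix.diagonal fun i => (d i : ℂ)) k i :=
    fun k => congrFun (congrFun hp k) i
  rw [← e.sum_repr (b i : V)]
  simp only [h1]
  rcases i with j | j
  · simp [frame_inl]
  · rw [frame_inr]
    simp only [Matrix.fromCols_apply_inr, Matrix.diagonal_apply, ite_smul, zero_smul,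
      Finset.sum_ite_eq', Finset.mem_univ, if_true, Sum.elim_inr]
    rw [← Complex.coe_smul]
    simp

/-- Dividing the last `g` basis vectors by the `d_k` turns type `(d_1, …, d_g)` into principal type
and the period matrix `(τ, D)` into `(τ, 1)`. -/
theorem IsSymplecticBasis.isFrame (h : L.IsSymplecticBasis d b) {e : Module.Basis (Fin g) ℂ V}
    {τ : Matrix (Fin g) (Fin g) ℂ}
    (hp : periodMatrix e b = Matrix.fromCols τ (Matrix.diagonal fun i => (d i : ℂ))) :
    L.IsFrame τ e := by
  have hd : ∀ i, (d i : ℝ) ≠ 0 := fun i => by exact_mod_cast (h.pos i).ne'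
  have hb := basis_eq_smul_frame hp
  ext i j
  have h1 := h.imForm_eq L i j
  rw [hb i, hb j] at h1
  simp only [LinearMap.map_smul, LinearMap.smul_apply, smul_eq_mul] at h1
  rw [Matrix.of_apply, Matrix.neg_apply]
  rcases i with i | i <;> rcases j with j | j
  · simpa [Matrix.J] using h1
  · by_cases hij : i = j
    · subst hij
      simpa [Matrix.J, hd] using h1
    · simpa [Matrix.J, hd, hij, Ne.symm hij] using h1
  · by_cases hij : i = j
    · subst hij
      have h2 : (d i : ℝ) * (L.imForm (frame τ e (Sum.inr i)) (frame τ e (Sum.inl i)) + 1) = 0 := by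
        simp at h1
        linarith
      have h3 := (mul_eq_zero.1 h2).resolve_left (hd i)
      simp [Matrix.J]
      linarith
    · simpa [Matrix.J, hd, hij, Ne.symm hij] using h1
  · simpa [Matrix.J, hd] using h1

end ComplexTorus.Polarization

/-! ### The two inequalities with their constants. -/

theorem proposition5p1 :
    ∃ δ : ℕ → ℕ → ℕ, Computable₂ δ ∧ (∀ g N, 0 < δ g N) ∧
      ∀ (g : ℕ) (hg : 0 < g) (Γ : Subgroup (Sp g)) [Γ.FiniteIndex]
        (n : ℕ) (σ : Fin n → Sp g) (_ : IsRightCosetReps Γ σ)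
        (V : Type*) [NormedAddCommGroup V] [NormedSpace ℂ V]
        (Λ : Submodule ℤ V) [DiscreteTopology Λ] [IsZLattice ℝ Λ] (L : Polarization Λ)
        (d : Fin g → ℕ) (b : Module.Basis (Fin g ⊕ Fin g) ℤ Λ) (_ : L.IsSymplecticBasis d b)
        (e : Module.Basis (Fin g) ℂ V) (τ : Matrix (Fin g) (Fin g) ℂ)
        (_ : periodMatrix e b = Matrix.fromCols τ (Matrix.diagonal fun i => (d i : ℂ)))
        (_ : τ ∈ siegelDomain σ)
        (Z : Matrix (Fin g) (Fin g) ℂ) (_ : Z ∈ fundamentalDomain g)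
        (_ : ∃ s : Sp g, τ = act s Z)
        (f : Hom0 Λ Λ),
        1 / (2 * (g : ℝ)) * √((d ⟨0, hg⟩ : ℝ) / d ⟨g - 1, Nat.sub_one_lt_of_lt hg⟩) *
            √(((ratRep b (Hom0.comp (L.rosati f) f)).trace : ℚ) : ℝ)
          ≤ supNorm ((ratRep b f).map (Rat.cast : ℚ → ℝ)) ∧
        supNorm ((ratRep b f).map (Rat.cast : ℚ → ℝ))
          ≤ (δ g (maxEntry σ) *
              (supNorm (Matrix.diagonal fun i => (d i : ℝ)) ^ (2 * g + 2) /
                ((∏ i, d i : ℕ) : ℝ)) *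
              max 1 (supNorm (Z.map Complex.im)) ^ (2 * g ^ 3 + 3 * g ^ 2 + 2 * g + 1)) *
            √(((ratRep b (Hom0.comp (L.rosati f) f)).trace : ℚ) : ℝ) := by
  refine ⟨repBound, computable_repBound, fun g N => Nat.succ_pos _, ?_⟩
  intro g hg Γ _ n σ _ V _ _ Λ _ _ L d b hb e τ hp hτ Z hZ ⟨s, hs⟩ f
  have : FiniteDimensional ℂ V := Module.Basis.finiteDimensional_of_finite e
  rw [trace_ratRep_comp]
  change _ * √_ ≤ supNorm (realRep b f) ∧ supNorm (realRep b f) ≤ _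
  set T := (realRep b (L.rosati f) * realRep b f).trace
  have hd1 : ∀ i, (1 : ℝ) ≤ d i := fun i => by exact_mod_cast hb.pos i
  constructor
  · set d₁ : ℝ := (d ⟨0, hg⟩ : ℝ)
    set dg : ℝ := (d ⟨g - 1, Nat.sub_one_lt_of_lt hg⟩ : ℝ)
    have hd₁ : 0 < d₁ := one_pos.trans_le (hd1 _)
    have hdg : 0 < dg := one_pos.trans_le (hd1 _)
    -- By divisibility `d_1` is the smallest and `d_g` the largest of the `d_i`.
    have hc : ∀ i j, (d i : ℝ) / d j ≤ dg / d₁ := by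
      intro i j
      refine div_le_div₀ hdg.le ?_ hd₁ ?_
      · exact Nat.cast_le.2 <| Nat.le_of_dvd (hb.pos _)
          (hb.dvd i ⟨g - 1, Nat.sub_one_lt_of_lt hg⟩ (Nat.le_sub_one_of_lt i.2))
      · exact Nat.cast_le.2 <| Nat.le_of_dvd (hb.pos _) (hb.dvd ⟨0, hg⟩ j (Nat.zero_le _))
    have htr := hb.trace_rosati_le L f hc
    have hg' : (0 : ℝ) < g := by exact_mod_cast hg
    rw [mul_assoc, ← Real.sqrt_mul (div_pos hd₁ hdg).le, one_div, inv_mul_le_iff₀ (by positivity)]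
    refine Real.sqrt_le_iff.2 ⟨mul_nonneg (by positivity) (supNorm_nonneg _), ?_⟩
    calc d₁ / dg * T ≤ d₁ / dg * ((2 * g) ^ 2 * (dg / d₁) * supNorm (realRep b f) ^ 2) :=
          mul_le_mul_of_nonneg_left htr (div_pos hd₁ hdg).le
      _ = (2 * g * supNorm (realRep b f)) ^ 2 := by field_simp
  · obtain ⟨k, Z', hZ', hk⟩ := Set.mem_iUnion.1 hτ
    set t : ℝ := max 1 (supNorm (Z.map Complex.im))
    have ht1 : 1 ≤ t := le_max_left _ _
    set D : ℝ := supNorm (Matrix.diagonal fun i => (d i : ℝ)) with hD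
    have hdD : ∀ i, (d i : ℝ) ≤ D := fun i => by
      have := abs_le_supNorm (Matrix.diagonal fun i => (d i : ℝ)) i i
      rw [Matrix.diagonal_apply_eq] at this
      exact (le_abs_self _).trans this
    have hD1 : 1 ≤ D := (hd1 ⟨0, hg⟩).trans (hdD _)
    have hframe := (hb.isFrame hp).reForm_frame_act_le hs hk.symm hZ hZ' ht1
      (fun i j => (abs_le_supNorm _ i j).trans (le_max_right _ _)) (natAbs_le_maxEntry σ k)
    set δ : ℝ := (repBound g (maxEntry σ) : ℝ)
    have hδ : 0 ≤ δ := Nat.cast_nonneg _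
    have hN : ∀ j, L.reForm (b j) (b j) ≤ D ^ 2 * (δ * t ^ (4 * g ^ 2)) := by
      intro j
      rw [Polarization.basis_eq_smul_frame hp j]
      simp only [LinearMap.map_smul, LinearMap.smul_apply, smul_eq_mul, ← mul_assoc, ← sq]
      rw [mul_assoc]
      refine mul_le_mul ?_ (hframe j) (L.reForm_self_nonneg _) (by positivity)
      rcases j with j | j
      · rw [Sum.elim_inl, one_pow]
        exact one_le_pow₀ hD1
      · exact pow_le_pow_left₀ (Nat.cast_nonneg _) (hdD j) 2
    refine (hb.supNorm_realRep_le L f hg hN).trans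
      (mul_le_mul_of_nonneg_right ?_ (Real.sqrt_nonneg _))
    have hprod : ((∏ i, d i : ℕ) : ℝ) ≤ D ^ g := by
      rw [Nat.cast_prod]
      have := Finset.prod_le_prod (s := Finset.univ) (fun i _ => Nat.cast_nonneg (α := ℝ) (d i))
        (fun i _ => hdD i)
      simpa using this
    have hprod0 : (0 : ℝ) < ((∏ i, d i : ℕ) : ℝ) := by
      exact_mod_cast Finset.prod_pos fun i _ => hb.pos i
    -- Since `d ≤ D^g` and `D ≥ 1`, passing to the stated power of `D` loses nothing essential.
    have h1 : D ^ 2 ≤ D ^ (2 * g + 2) / ((∏ i, d i : ℕ) : ℝ) := by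
      rw [le_div_iff₀ hprod0]
      calc D ^ 2 * ((∏ i, d i : ℕ) : ℝ) ≤ D ^ 2 * D ^ g :=
            mul_le_mul_of_nonneg_left hprod (by positivity)
        _ = D ^ (2 + g) := (pow_add _ _ _).symm
        _ ≤ D ^ (2 * g + 2) := pow_le_pow_right₀ hD1 (by omega)
    have h2 : t ^ (4 * g ^ 2) ≤ t ^ (2 * g ^ 3 + 3 * g ^ 2 + 2 * g + 1) := by
      refine pow_le_pow_right₀ ht1 ?_
      have : g ^ 2 ≤ g ^ 3 := Nat.pow_le_pow_right hg (by norm_num)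
      omega
    calc D ^ 2 * (δ * t ^ (4 * g ^ 2)) = δ * D ^ 2 * t ^ (4 * g ^ 2) := by ring
      _ ≤ _ := mul_le_mul (mul_le_mul_of_nonneg_left h1 hδ) h2 (by positivity)
          (mul_nonneg hδ (by positivity))
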